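/- Let $G$ be a finite bipartite graph (parallel edges allowed) with color classes $A$ and $B$, $n$ vertices and $m$ edges, and let $b\colon V(G)\to\mathbb{Z}_{\ge 0}$. A set $M$ of edges is a $b$-matching if every vertex $v$ is an end of at most $b(v)$ edges of $M$; it is maximum if it has the largest possible number of edges. An edge is *allowed* if some maximum $b$-matching contains it and *forbidden* otherwise; it is *inevitable* if every maximum $b$-matching contains it, and *flexible* if it is allowed but not inevitable. The *flexible components* of $G$ are the subgraphs induced by the vertex sets of the connected components of the spanning subgraph formed by the flexible edges. For flexible components $C, D$ write $C\le^\circ_A D$ if $C=D$, or there is an inevitable edge between $V(C)\cap A$ and $V(D)\cap B$, or there is a forbidden edge between $V(D)\cap A$ and $V(C)\cap B$; and let $C\le_A D$ if there are flexible components $C=D_1\le^\circ_A D_2\le^\circ_A\dots\le^\circ_A D_k=D$ with $k\ge 1$. Let $D(G;b)$ be the set of vertices $v$ that are incident with fewer than $b(v)$ edges of some maximum $b$-matching. For $W\in\{A,B\}$, a flexible component $C$ is *inconsistent and hooked up by $W$* if $V(C)\cap D(G;b)\cap W\neq\emptyset$, or if $C$ consists of a single vertex $v$ with $b(v)=0$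 and $v$ is a neighbor of $D(G;b)\cap W$; it is *consistent* if $V(C)\cap D(G;b)=\emptyset$ and it is not a single vertex $v$ with $b(v)=0$ that is a neighbor of $D(G;b)$. The *$b$-matching Dulmage–Mendelsohn decomposition* of $G$ consists of the set of flexible components, the relation $\le_A$ on it, and the division of the flexible components into consistent ones, inconsistent ones hooked up by $A$, and inconsistent ones hooked up by $B$. **Theorem.** Given a bipartite graph $G$ with color classes $A$ and $B$ and a map $b\colon V(G)\to\mathbb{Z}_{\ge 0}$, the $b$-matching Dulmage–Mendelsohn decomposition of $G$ can be computed in strongly polynomial time. That is, there are a single random access machine program (with the unit-cost operations: memory access, addition, subtraction, multiplication and comparison of integers) and polynomials $p$, $q$ such that for every $G$ and $b$ the program halts after at most $p(n+m)$ elementary operations, independently of the magnitude of the values of $b$; all integers that occur during the run have at most $q(s)$ binary digits, where $s$ is $n+m$ plus the total binary length of the values of $b$; and the output is the decomposition: the partition of $V(G)$ into flexible components, the full relation $\le_A$, and for each component whether it is consistent, inconsistent and hooked up by $A$, or inconsistent and hooked up by $B$. -/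

import Mathlib

/-! ### Random access machines with unit-cost arithmetic

Programs are structured (sequencing, branching, loops).  They act on integer variables and on
integer arrays that are accessed through computed indices; a program text mentions finitely many of
them. -/

namespace RAM

/-- The memory: variables (named by numbers) and integer arrays (named by numbers). -/
structure State where
  var : ℕ → ℤ
  arr : ℕ → ℤ → ℤ

/-- Integer expressions. -/
inductive Expr where
  | const (c : ℤ)
  | var (x : ℕ)
  | load (a : ℕ) (i : Expr)
  | add (e f : Expr)
  | sub (e f : Expr)
  | mul (e f : Expr)

/-- Tests: comparisons of integers and their Boolean combinations. -/
inductive Test where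
  | lt (e f : Expr)
  | eq (e f : Expr)
  | not (c : Test)
  | and (c d : Test)

/-- Programs. -/
inductive Prog where
  | skip
  | assign (x : ℕ) (e : Expr)
  | store (a : ℕ) (i e : Expr)
  | seq (P Q : Prog)
  | ite (c : Test) (P Q : Prog)
  | while (c : Test) (P : Prog)

/-- The value of an expression. -/
def Expr.eval (σ : State) : Expr → ℤ
  | const c => c
  | var x => σ.var x
  | load a i => σ.arr a (i.eval σ)
  | add e f => e.eval σ + f.eval σ
  | sub e f => e.eval σ - f.eval σ
  | mul e f => e.eval σ * f.eval σ

/-- The number of elementary operations (memory accesses and arithmetic operations, each counted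
once whatever the size of the operands) in the evaluation of an expression. -/
def Expr.cost : Expr → ℕ
  | const _ => 1
  | var _ => 1
  | load _ i => i.cost + 1
  | add e f => e.cost + f.cost + 1
  | sub e f => e.cost + f.cost + 1
  | mul e f => e.cost + f.cost + 1

/-- Every integer that occurs in the evaluation of the expression, intermediate results and
indices included, has at most `L` binary digits. -/
def Expr.Fits (L : ℕ) (σ : State) : Expr → Prop
  | const c => c.natAbs < 2 ^ L
  | var x => (σ.var x).natAbs < 2 ^ L
  | load a i => i.Fits L σ ∧ (σ.arr a (i.eval σ)).natAbs < 2 ^ L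
  | add e f => e.Fits L σ ∧ f.Fits L σ ∧ (e.eval σ + f.eval σ).natAbs < 2 ^ L
  | sub e f => e.Fits L σ ∧ f.Fits L σ ∧ (e.eval σ - f.eval σ).natAbs < 2 ^ L
  | mul e f => e.Fits L σ ∧ f.Fits L σ ∧ (e.eval σ * f.eval σ).natAbs < 2 ^ L

/-- The outcome of a test. -/
def Test.Holds (σ : State) : Test → Prop
  | lt e f => e.eval σ < f.eval σ
  | eq e f => e.eval σ = f.eval σ
  | not c => ¬ c.Holds σ
  | and c d => c.Holds σ ∧ d.Holds σ

/-- The number of elementary operations in a test. -/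
def Test.cost : Test → ℕ
  | lt e f => e.cost + f.cost + 1
  | eq e f => e.cost + f.cost + 1
  | not c => c.cost + 1
  | and c d => c.cost + d.cost + 1

/-- Every integer that occurs in the test has at most `L` binary digits. -/
def Test.Fits (L : ℕ) (σ : State) : Test → Prop
  | lt e f => e.Fits L σ ∧ f.Fits L σ
  | eq e f => e.Fits L σ ∧ f.Fits L σ
  | not c => c.Fits L σ
  | and c d => c.Fits L σ ∧ d.Fits L σ

/-- Assignment to a variable. -/
def State.setVar (σ : State) (x : ℕ) (z : ℤ) : State :=
  { σ with var := Function.update σ.var x z }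

/-- Assignment to an array cell. -/
def State.setArr (σ : State) (a : ℕ) (i z : ℤ) : State :=
  { σ with arr := Function.update σ.arr a (Function.update (σ.arr a) i z) }

/-- `Exec L P σ t τ`: started in the memory `σ`, the program `P` halts in the memory `τ` after
exactly `t` elementary operations, and every integer that occurs during the run has at most `L`
binary digits. -/
inductive Exec (L : ℕ) : Prog → State → ℕ → State → Prop
  | skip (σ : State) : Exec L .skip σ 1 σ
  | assign (σ : State) (x : ℕ) (e : Expr) (he : e.Fits L σ) :
      Exec L (.assign x e) σ (e.cost + 1) (σ.setVar x (e.eval σ))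
  | store (σ : State) (a : ℕ) (i e : Expr) (hi : i.Fits L σ) (he : e.Fits L σ) :
      Exec L (.store a i e) σ (i.cost + e.cost + 1) (σ.setArr a (i.eval σ) (e.eval σ))
  | seq {P Q : Prog} {σ τ ρ : State} {s t : ℕ} (hP : Exec L P σ s τ) (hQ : Exec L Q τ t ρ) :
      Exec L (.seq P Q) σ (s + t) ρ
  | ite_true {c : Test} {P Q : Prog} {σ τ : State} {t : ℕ} (hf : c.Fits L σ) (hc : c.Holds σ)
      (hP : Exec L P σ t τ) : Exec L (.ite c P Q) σ (c.cost + 1 + t) τ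
  | ite_false {c : Test} {P Q : Prog} {σ τ : State} {t : ℕ} (hf : c.Fits L σ) (hc : ¬ c.Holds σ)
      (hQ : Exec L Q σ t τ) : Exec L (.ite c P Q) σ (c.cost + 1 + t) τ
  | while_false {c : Test} {P : Prog} {σ : State} (hf : c.Fits L σ) (hc : ¬ c.Holds σ) :
      Exec L (.while c P) σ (c.cost + 1) σ
  | while_true {c : Test} {P : Prog} {σ τ ρ : State} {s t : ℕ} (hf : c.Fits L σ)
      (hc : c.Holds σ) (hP : Exec L P σ s τ) (hW : Exec L (.while c P) τ t ρ) :
      Exec L (.while c P) σ (c.cost + 1 + s + t) ρ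

/-- A computational problem with instances `x : I`, each presented in the memory `input x` and
solved by the memories `τ` with `Solves x τ`, is solvable in strongly polynomial time: one fixed
program solves every instance, the number of elementary operations is bounded by a polynomial in the
dimension `dim x` (which does not take the magnitude of the numbers in the input into account), and
the binary length of all integers that occur is bounded by a polynomial in the binary length
`size x` of the input. -/
def StronglyPolynomialTime {I : Type*} (dim size : I → ℕ) (input : I → State)
    (Solves : I → State → Prop) : Prop :=
  ∃ (P : Prog) (p q : Polynomial ℕ), ∀ x : I, ∃ (t : ℕ) (τ : State),
    Exec (q.eval (size x)) P (input x) t τ ∧ t ≤ p.eval (dim x) ∧ Solves x τ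

end RAM

/-! ### Bipartite graphs and `b`-matchings -/

/-- A bipartite graph with vertex set `V` and edge set `E`, parallel edges allowed, together with
its color classes `A` (color `true`) and `B` (color `false`). -/
structure BipartiteGraph (V E : Type*) where
  color : V → Bool
  endA : E → V
  endB : E → V
  color_endA : ∀ e, color (endA e) = true
  color_endB : ∀ e, color (endB e) = false

namespace BipartiteGraph

variable {V E : Type*} (G : BipartiteGraph V E) (b : V → ℕ)

/-- The color class `A`. -/
def A : Set V := {v | G.color v = true}

/-- The color class `B`. -/
def B : Set V := {v | G.color v = false}

/-- The edge `e` has one end in `X` and the other one in `Y`. -/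
def Between (X Y : Set V) (e : E) : Prop :=
  (G.endA e ∈ X ∧ G.endB e ∈ Y) ∨ (G.endB e ∈ X ∧ G.endA e ∈ Y)

/-- The vertices outside of `X` that are adjacent to a vertex of `X`. -/
def neighbors (X : Set V) : Set V := {v | v ∉ X ∧ ∃ e, G.Between {v} X e}

open Classical in
/-- The number of edges of `M` at the vertex `v`. -/
noncomputable def degree (M : Finset E) (v : V) : ℕ :=
  (M.filter fun e => G.endA e = v ∨ G.endB e = v).card

/-- `M` is a `b`-matching. -/
def IsBMatching (M : Finset E) : Prop := ∀ v, G.degree M v ≤ b v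

/-- `M` is a maximum `b`-matching. -/
def IsMaxBMatching (M : Finset E) : Prop :=
  G.IsBMatching b M ∧ ∀ N : Finset E, G.IsBMatching b N → N.card ≤ M.card

/-- `b`-allowed edges. -/
def Allowed (e : E) : Prop := ∃ M, G.IsMaxBMatching b M ∧ e ∈ M

/-- `b`-forbidden edges. -/
def Forbidden (e : E) : Prop := ¬ G.Allowed b e

/-- `b`-inevitable edges. -/
def Inevitable (e : E) : Prop := G.Allowed b e ∧ ∀ M, G.IsMaxBMatching b M → e ∈ M

/-- `b`-flexible edges. -/
def Flexible (e : E) : Prop := G.Allowed b e ∧ ¬ G.Inevitable b e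

/-- The vertices `u` and `v` are joined by a `b`-flexible edge. -/
def FlexAdj (u v : V) : Prop := ∃ e, G.Flexible b e ∧ G.Between {u} {v} e

/-- The vertex set of the `b`-flexible component that contains `v`, that is, of the connected
component of `v` in the spanning subgraph formed by the `b`-flexible edges.  The component itself is
the subgraph induced by this set. -/
def flexComp (v : V) : Set V := {u | Relation.ReflTransGen (G.FlexAdj b) v u}

/-- The type of `b`-flexible components, each represented by its vertex set. -/
def FlexComps : Type _ := {C : Set V // ∃ v, C = G.flexComp b v}

/-- The `b`-flexible component of `v`, as an element of the type of `b`-flexible components. -/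
def flexCompOf (v : V) : G.FlexComps b := ⟨G.flexComp b v, v, rfl⟩

/-- The vertices that are loose for some maximum `b`-matching. -/
def looseVertices : Set V := {v | ∃ M, G.IsMaxBMatching b M ∧ G.degree M v < b v}

/-- `C` is `b`-inconsistent: it is `b`-loose, or it consists of a single vertex `v` with `b v = 0`
that is a neighbor of the set of loose vertices. -/
def Inconsistent (C : Set V) : Prop :=
  (C ∩ G.looseVertices b).Nonempty ∨
    ∃ v, C = {v} ∧ b v = 0 ∧ v ∈ G.neighbors (G.looseVertices b)

/-- `C` is `b`-inconsistent and hooked up by `W`. -/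
def InconsistentHookedBy (W C : Set V) : Prop :=
  (C ∩ G.looseVertices b ∩ W).Nonempty ∨
    ∃ v, C = {v} ∧ b v = 0 ∧ v ∈ G.neighbors (G.looseVertices b ∩ W)

/-- The generating relation of the order on `b`-flexible components, with respect to the color class
`W`. -/
def BasicLE (W : Set V) (C D : G.FlexComps b) : Prop :=
  C = D ∨ (∃ e, G.Inevitable b e ∧ G.Between (C.1 ∩ W) (D.1 ∩ Wᶜ) e) ∨
    ∃ e, G.Forbidden b e ∧ G.Between (D.1 ∩ W) (C.1 ∩ Wᶜ) e

/-- The order on `b`-flexible components with respect to the color class `W`: there is a finite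
chain of `b`-flexible components from `C` to `D` whose consecutive members are in the generating
relation. -/
def FlexLE (W : Set V) (C D : G.FlexComps b) : Prop :=
  Relation.ReflTransGen (G.BasicLE b W) C D

end BipartiteGraph

/-! ### The computational problem -/

/-- An instance: a bipartite graph with vertices `0, …, n - 1` and edges `0, …, m - 1`, and a map
`b` from the vertices to the nonnegative integers. -/
structure BMatchingInstance where
  n : ℕ
  m : ℕ
  G : BipartiteGraph (Fin n) (Fin m)
  b : Fin n → ℕ

namespace BMatchingInstance

/-- The dimension of the input: the number of vertices plus the number of edges. -/
def dim (x : BMatchingInstance) : ℕ := x.n + x.m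

/-- The size of the input: the dimension plus the total binary length of the values of `b`. -/
def size (x : BMatchingInstance) : ℕ := x.n + x.m + ∑ v, (x.b v).size

/-- The array contents `f 0, …, f (k - 1)`, with `0` in all other cells. -/
def tabulate {k : ℕ} (f : Fin k → ℤ) (i : ℤ) : ℤ :=
  if h : 0 ≤ i ∧ i < k then f ⟨i.toNat, by omega⟩ else 0

/-- The memory that presents the instance: variables `0` and `1` hold `n` and `m`, array `0` lists
the values of `b`, array `1` is the indicator of the color class `A`, arrays `2` and `3` list the
ends of the edges in `A` and in `B`, and everything else is `0`. -/
def input (x : BMatchingInstance) : RAM.State where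
  var
    | 0 => x.n
    | 1 => x.m
    | _ => 0
  arr
    | 0 => tabulate fun v => (x.b v : ℤ)
    | 1 => tabulate fun v => if x.G.color v = true then 1 else 0
    | 2 => tabulate fun e => ((x.G.endA e : ℕ) : ℤ)
    | 3 => tabulate fun e => ((x.G.endB e : ℕ) : ℤ)
    | _ => fun _ => 0

/-- The number `z` is the truth value of `p`. -/
def IsTruthValue (z : ℤ) (p : Prop) : Prop := (p ∧ z = 1) ∨ (¬ p ∧ z = 0)

/-- The memory `τ` holds the `b`-matching Dulmage-Mendelsohn decomposition of the instance:
* array `4` partitions the vertices into the `b`-flexible components: two vertices carry the same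
  label exactly if they are in the same `b`-flexible component;
* array `5` is the `n × n` matrix of the order with respect to the color class `A`, its entry in row
  `u` and column `v` telling whether the component of `u` is below the component of `v`;
* arrays `6`, `7`, `8` tell for every vertex whether its component is inconsistent and hooked up by
  `A`, inconsistent and hooked up by `B`, or consistent. -/
def HoldsDecomposition (x : BMatchingInstance) (τ : RAM.State) : Prop :=
  (∀ u v : Fin x.n, τ.arr 4 u.val = τ.arr 4 v.val ↔ x.G.flexComp x.b u = x.G.flexComp x.b v) ∧
  (∀ u v : Fin x.n, IsTruthValue (τ.arr 5 (u.val * x.n + v.val))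
    (x.G.FlexLE x.b x.G.A (x.G.flexCompOf x.b u) (x.G.flexCompOf x.b v))) ∧
  ∀ v : Fin x.n,
    IsTruthValue (τ.arr 6 v.val)
      (x.G.InconsistentHookedBy x.b x.G.A (x.G.flexComp x.b v)) ∧
    IsTruthValue (τ.arr 7 v.val)
      (x.G.InconsistentHookedBy x.b x.G.B (x.G.flexComp x.b v)) ∧
    IsTruthValue (τ.arr 8 v.val)
      (¬ x.G.Inconsistent x.b (x.G.flexComp x.b v))

end BMatchingInstance

/-! The whole decomposition can be read off from sizes of maximum `b`-matchings of slightly modified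
instances. A vertex `v` with `b v > 0` is loose iff lowering `b v` by one does not change the
maximum (`mem_looseVertices_iff`). An edge is inevitable iff deleting it changes the maximum
(`inevitable_iff`). An edge with positive values at both ends is allowed iff deleting it and
lowering `b` by one at both ends decreases the maximum by exactly one (`allowed_iff`). So one
maximum size for the instance itself, at most one for each vertex and at most two for each edge
suffice. The rest is reachability: the flexible components are those of an undirected graph, and the
order is reachability in the digraph in which allowed edges are directed from `A` to `B` and edges
that are not inevitable from `B` to `A` (`flexLE_iff`). Flexible edges yield arcs both ways, which
makes each component strongly connected. Warshall's algorithm computes both closures.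

A maximum `b`-matching is found by augmentation. The search from the loose vertices of `A` stores a
complete modified edge set for every reached vertex instead of a path (`SearchInv`). If it gets
stuck without reaching a loose vertex of `B`, the reached set gives a dual bound that proves
maximality (`isMaxIn_of_closed`). A `b`-matching is a set of edges, so it has at most `m` of them
whatever the values of `b`; hence `m` augmentations, each with `n` rounds through the edges, always
suffice. This is why the running time does not depend on the magnitude of `b`.

The complexity bounds are a matter of syntax. A program whose only loops count up to `n` or `m`
takes polynomially many steps. Without multiplication every operation increases binary lengths by a
bounded amount only, so these grow by at most a polynomial (`exec_compile`,
`stronglyPolynomialTime_of_run`). The products needed as matrix indices come from tables of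
multiples of `m` and `n` that are built by repeated addition. What remains is to verify the program
`decompose` by loop invariants (`holdsDecomposition_run`). -/

/-! ### Bounded loop programs

A loop program uses no multiplication, and its only loops are counting loops up to the contents of
variable `0` or `1`.  Its effect is a total function of the memory, its running time is polynomial
in these two contents, and so is the growth of the binary length of the numbers. -/

namespace RAM

/-- Programs with counting loops: `loop x y P` runs `P` with `x = 0, 1, …` as long as `x` is less
than the content of the variable `y`. -/
inductive LProg where
  | skip
  | assign (x : ℕ) (e : Expr)
  | store (a : ℕ) (i e : Expr)
  | seq (P Q : LProg)
  | ite (c : Test) (P Q : LProg)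
  | loop (x y : ℕ) (P : LProg)

/-- A bound for the cost of an expression and for the growth of binary lengths it causes. -/
def Expr.weight : Expr → ℕ
  -- The summand `c.natAbs` comes from the crude bound `|c| < 2 ^ |c|`.
  | const c => c.natAbs + 1
  | var _ => 1
  | load _ i => i.weight + 1
  | add e f => e.weight + f.weight + 1
  | sub e f => e.weight + f.weight + 1
  | mul e f => e.weight + f.weight + 1

/-- The expression contains no multiplication. -/
def Expr.mulFree : Expr → Bool
  | const _ => true
  | var _ => true
  | load _ i => i.mulFree
  | add e f => e.mulFree && f.mulFree
  | sub e f => e.mulFree && f.mulFree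
  | mul _ _ => false

/-- A bound for the cost of a test and for the binary lengths that occur in it. -/
def Test.weight : Test → ℕ
  | lt e f => e.weight + f.weight + 1
  | eq e f => e.weight + f.weight + 1
  | not c => c.weight + 1
  | and c d => c.weight + d.weight + 1

/-- The test contains no multiplication. -/
def Test.mulFree : Test → Bool
  | lt e f => e.mulFree && f.mulFree
  | eq e f => e.mulFree && f.mulFree
  | not c => c.mulFree
  | and c d => c.mulFree && d.mulFree

namespace LProg

/-- The variables to which the program assigns. -/
def vars : LProg → List ℕ
  | skip => []
  | assign x _ => [x]
  | store _ _ _ => []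
  | seq P Q => P.vars ++ Q.vars
  | ite _ P Q => P.vars ++ Q.vars
  | loop x _ P => x :: P.vars

/-- The arrays in which the program stores. -/
def arrs : LProg → List ℕ
  | skip => []
  | assign _ _ => []
  | store a _ _ => [a]
  | seq P Q => P.arrs ++ Q.arrs
  | ite _ P Q => P.arrs ++ Q.arrs
  | loop _ _ P => P.arrs

/-- No multiplications, no assignments to the variables `0` and `1`, only these two as loop bounds,
and no assignments to the counter of a loop in its body. -/
def wf : LProg → Bool
  | skip => true
  | assign x e => decide (2 ≤ x) && e.mulFree
  | store _ i e => i.mulFree && e.mulFree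
  | seq P Q => P.wf && Q.wf
  | ite c P Q => c.mulFree && P.wf && Q.wf
  | loop x y P => decide (2 ≤ x) && decide (y < 2) && decide (x ∉ P.vars) && P.wf

/-- The translation into a random access machine program. -/
def compile : LProg → Prog
  | skip => .skip
  | assign x e => .assign x e
  | store a i e => .store a i e
  | seq P Q => .seq P.compile Q.compile
  | ite c P Q => .ite c P.compile Q.compile
  | loop x y P => .seq (.assign x (.const 0))
      (.while (.lt (.var x) (.var y)) (.seq P.compile (.assign x (.add (.var x) (.const 1)))))

open Classical in
/-- The effect of the program on the memory. -/
noncomputable def run : LProg → State → State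
  | skip, σ => σ
  | assign x e, σ => σ.setVar x (e.eval σ)
  | store a i e, σ => σ.setArr a (i.eval σ) (e.eval σ)
  | seq P Q, σ => Q.run (P.run σ)
  | ite c P Q, σ => if c.Holds σ then P.run σ else Q.run σ
  -- The number of rounds is read off once, at the start. This agrees with the translated `while`
  -- loop because `wf` restricts `y` to the variables `0` and `1`, which are never assigned.
  | loop x y P, σ => Nat.rec (σ.setVar x 0) (fun i s => (P.run s).setVar x ((i + 1 : ℕ) : ℤ))
      (σ.var y).toNat

/-- A bound for the running time and for the growth of binary lengths, as a polynomial in the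
largest loop bound. -/
noncomputable def bound : LProg → Polynomial ℕ
  | skip => 1
  | assign _ e => .C (e.weight + 1)
  | store _ i e => .C (i.weight + e.weight + 1)
  | seq P Q => P.bound + Q.bound
  | ite c P Q => .C (c.weight + 1) + P.bound + Q.bound
  -- Initializing the counter costs 2 and the final failing test 4; every round costs 4 for the test
  -- and 4 for increasing the counter, besides the body.
  | loop _ _ P => .C 6 + .X * (P.bound + .C 8)

end LProg

/-! ### Binary lengths in the evaluation of multiplication-free expressions. -/

/-- All numbers in the memory are at most `2 ^ k` in absolute value. -/
def State.Bounded (σ : State) (k : ℕ) : Prop :=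
  (∀ x, (σ.var x).natAbs ≤ 2 ^ k) ∧ ∀ a i, (σ.arr a i).natAbs ≤ 2 ^ k

theorem State.Bounded.mono {σ : State} {k l : ℕ} (h : σ.Bounded k) (hkl : k ≤ l) :
    σ.Bounded l :=
  ⟨fun x => (h.1 x).trans (Nat.pow_le_pow_right two_pos hkl),
    fun a i => (h.2 a i).trans (Nat.pow_le_pow_right two_pos hkl)⟩

theorem State.Bounded.setVar {σ : State} {k : ℕ} (h : σ.Bounded k) (x : ℕ) {z : ℤ}
    (hz : z.natAbs ≤ 2 ^ k) : (σ.setVar x z).Bounded k := by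
  refine ⟨fun y => ?_, h.2⟩
  by_cases hy : y = x
  · subst hy; simpa [State.setVar] using hz
  · simpa [State.setVar, hy] using h.1 y

theorem State.Bounded.setArr {σ : State} {k : ℕ} (h : σ.Bounded k) (a : ℕ) (i : ℤ) {z : ℤ}
    (hz : z.natAbs ≤ 2 ^ k) : (σ.setArr a i z).Bounded k := by
  refine ⟨h.1, fun c j => ?_⟩
  by_cases hc : c = a
  · subst hc
    by_cases hj : j = i
    · subst hj; simpa [State.setArr] using hz
    · simpa [State.setArr, hj] using h.2 c j
  · simpa [State.setArr, hc] using h.2 c j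

theorem Expr.cost_le_weight (e : Expr) : e.cost ≤ e.weight := by
  induction e <;> simp only [Expr.cost, Expr.weight] <;> omega

theorem Test.cost_le_weight (c : Test) : c.cost ≤ c.weight := by
  induction c with
  | lt e f | eq e f =>
    have := e.cost_le_weight; have := f.cost_le_weight
    simp only [Test.cost, Test.weight]; omega
  | not c ih => simp only [Test.cost, Test.weight]; omega
  | and c d ih ih' => simp only [Test.cost, Test.weight]; omega

theorem two_pow_add_two_pow_le (k a b : ℕ) : 2 ^ (k + a) + 2 ^ (k + b) ≤ 2 ^ (k + (a + b + 1)) := by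
  have h1 : 2 ^ (k + a) ≤ 2 ^ (k + (a + b)) := Nat.pow_le_pow_right two_pos (by omega)
  have h2 : 2 ^ (k + b) ≤ 2 ^ (k + (a + b)) := Nat.pow_le_pow_right two_pos (by omega)
  have h3 : 2 ^ (k + (a + b + 1)) = 2 * 2 ^ (k + (a + b)) := by rw [← add_assoc, pow_succ']
  omega

/-- A sum or difference adds at most one digit to the longer operand, so the exponent grows by a
number that depends on the expression only. A product could double the exponent `k`, which would
become exponential in a loop. -/
theorem Expr.natAbs_eval_le {σ : State} {k : ℕ} (h : σ.Bounded k) (e : Expr)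
    (he : e.mulFree = true) : (e.eval σ).natAbs ≤ 2 ^ (k + e.weight) := by
  induction e with
  | const c =>
    have h1 : c.natAbs < 2 ^ c.natAbs := Nat.lt_two_pow_self
    exact h1.le.trans (Nat.pow_le_pow_right two_pos (by simp only [Expr.weight]; omega))
  | var x => exact (h.1 x).trans (Nat.pow_le_pow_right two_pos (by omega))
  | load a i _ => exact (h.2 a _).trans (Nat.pow_le_pow_right two_pos (by omega))
  | add e f ihe ihf =>
    simp only [Expr.mulFree, Bool.and_eq_true] at he
    have := two_pow_add_two_pow_le k e.weight f.weight
    have := ihe he.1; have := ihf he.2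
    simp only [Expr.eval, Expr.weight]; omega
  | sub e f ihe ihf =>
    simp only [Expr.mulFree, Bool.and_eq_true] at he
    have := two_pow_add_two_pow_le k e.weight f.weight
    have := ihe he.1; have := ihf he.2
    simp only [Expr.eval, Expr.weight]; omega
  | mul e f => simp [Expr.mulFree] at he

theorem Expr.natAbs_eval_lt {σ : State} {k L : ℕ} (h : σ.Bounded k) (e : Expr)
    (he : e.mulFree = true) (hL : k + e.weight < L) : (e.eval σ).natAbs < 2 ^ L :=
  (e.natAbs_eval_le h he).trans_lt (Nat.pow_lt_pow_right one_lt_two hL)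

theorem Expr.fits {σ : State} {k L : ℕ} (h : σ.Bounded k) (e : Expr)
    (he : e.mulFree = true) (hL : k + e.weight < L) : e.Fits L σ := by
  have hlt := e.natAbs_eval_lt h he hL
  induction e with
  | const c => exact hlt
  | var x => exact hlt
  | load a i ih =>
    have hi : k + i.weight < L := by simp only [Expr.weight] at hL; omega
    exact ⟨ih he hi (i.natAbs_eval_lt h he hi), hlt⟩
  | add e f ihe ihf =>
    simp only [Expr.mulFree, Bool.and_eq_true] at he
    have h1 : k + e.weight < L := by simp only [Expr.weight] at hL; omega
    have h2 : k + f.weight < L := by simp only [Expr.weight] at hL; omega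
    exact ⟨ihe he.1 h1 (e.natAbs_eval_lt h he.1 h1), ihf he.2 h2 (f.natAbs_eval_lt h he.2 h2), hlt⟩
  | sub e f ihe ihf =>
    simp only [Expr.mulFree, Bool.and_eq_true] at he
    have h1 : k + e.weight < L := by simp only [Expr.weight] at hL; omega
    have h2 : k + f.weight < L := by simp only [Expr.weight] at hL; omega
    exact ⟨ihe he.1 h1 (e.natAbs_eval_lt h he.1 h1), ihf he.2 h2 (f.natAbs_eval_lt h he.2 h2), hlt⟩
  | mul e f => simp [Expr.mulFree] at he

theorem Test.fits {σ : State} {k L : ℕ} (h : σ.Bounded k) (c : Test)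
    (hc : c.mulFree = true) (hL : k + c.weight < L) : c.Fits L σ := by
  induction c with
  | lt e f | eq e f =>
    simp only [Test.mulFree, Bool.and_eq_true] at hc
    simp only [Test.weight] at hL
    exact ⟨e.fits h hc.1 (by omega), f.fits h hc.2 (by omega)⟩
  | not c ih =>
    simp only [Test.weight] at hL
    exact ih hc (by omega)
  | and c d ihc ihd =>
    simp only [Test.mulFree, Bool.and_eq_true] at hc
    simp only [Test.weight] at hL
    exact ⟨ihc hc.1 (by omega), ihd hc.2 (by omega)⟩

/-! ### Frame property, running time and growth of numbers for loop programs. -/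

namespace LProg

/-- The two memories agree outside of the variables `vs` and the arrays `as`. -/
def Agree (vs as : List ℕ) (σ τ : State) : Prop :=
  (∀ x ∉ vs, τ.var x = σ.var x) ∧ ∀ a ∉ as, τ.arr a = σ.arr a

/-- The states in a counting loop. -/
noncomputable def iter (x : ℕ) (P : LProg) (σ : State) (i : ℕ) : State :=
  Nat.rec (σ.setVar x 0) (fun i s => (P.run s).setVar x ((i + 1 : ℕ) : ℤ)) i

theorem iter_zero (x : ℕ) (P : LProg) (σ : State) : iter x P σ 0 = σ.setVar x 0 := rfl

theorem iter_succ (x : ℕ) (P : LProg) (σ : State) (i : ℕ) :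
    iter x P σ (i + 1) = (P.run (iter x P σ i)).setVar x ((i + 1 : ℕ) : ℤ) := rfl

theorem run_loop (x y : ℕ) (P : LProg) (σ : State) :
    (loop x y P).run σ = iter x P σ (σ.var y).toNat := rfl

theorem iter_var (x : ℕ) (P : LProg) (σ : State) (i : ℕ) : (iter x P σ i).var x = i := by
  cases i <;> simp [iter_zero, iter_succ, State.setVar]

theorem iter_agree {x : ℕ} {P : LProg} (ih : ∀ σ, Agree P.vars P.arrs σ (P.run σ)) (σ : State)
    (i : ℕ) : Agree (x :: P.vars) P.arrs σ (iter x P σ i) := by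
  induction i with
  | zero =>
    refine ⟨fun z hz => ?_, fun a _ => rfl⟩
    simp only [List.mem_cons, not_or] at hz
    simp [iter_zero, State.setVar, hz.1]
  | succ i ihi =>
    refine ⟨fun z hz => ?_, fun a ha => ?_⟩
    · rw [← ihi.1 z hz]
      simp only [List.mem_cons, not_or] at hz
      refine Eq.trans ?_ ((ih _).1 z hz.2)
      simp [iter_succ, State.setVar, hz.1]
    · exact ((ih _).2 a ha).trans (ihi.2 a ha)

/-- This is the frame rule. The lists `vars` and `arrs` are computed from the program text, so for
concrete programs `decide` proves that one stage leaves the results of another one intact. -/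
theorem run_agree (P : LProg) (σ : State) : Agree P.vars P.arrs σ (P.run σ) := by
  induction P generalizing σ with
  | skip => exact ⟨fun _ _ => rfl, fun _ _ => rfl⟩
  | assign x e =>
    refine ⟨fun z hz => ?_, fun _ _ => rfl⟩
    simp only [vars, List.mem_singleton] at hz
    simp [run, State.setVar, hz]
  | store a i e =>
    refine ⟨fun _ _ => rfl, fun c hc => ?_⟩
    simp only [arrs, List.mem_singleton] at hc
    simp [run, State.setArr, hc]
  | seq P Q ihP ihQ =>
    refine ⟨fun z hz => ?_, fun c hc => ?_⟩
    · simp only [vars, List.mem_append, not_or] at hz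
      exact ((ihQ _).1 z hz.2).trans ((ihP _).1 z hz.1)
    · simp only [arrs, List.mem_append, not_or] at hc
      exact ((ihQ _).2 c hc.2).trans ((ihP _).2 c hc.1)
  | ite t P Q ihP ihQ =>
    refine ⟨fun z hz => ?_, fun c hc => ?_⟩
    · simp only [vars, List.mem_append, not_or] at hz
      simp only [run]; split_ifs
      exacts [(ihP _).1 z hz.1, (ihQ _).1 z hz.2]
    · simp only [arrs, List.mem_append, not_or] at hc
      simp only [run]; split_ifs
      exacts [(ihP _).2 c hc.1, (ihQ _).2 c hc.2]
  | loop x y P ih => exact iter_agree ih σ _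

theorem run_var {P : LProg} {x : ℕ} (h : x ∉ P.vars) (σ : State) : (P.run σ).var x = σ.var x :=
  (P.run_agree σ).1 x h

theorem run_arr {P : LProg} {a : ℕ} (h : a ∉ P.arrs) (σ : State) : (P.run σ).arr a = σ.arr a :=
  (P.run_agree σ).2 a h

/-- It follows that the loop bounds, variables `0` and `1`, keep their values during the whole run.
-/
theorem two_le_of_mem_vars {P : LProg} (hP : P.wf = true) {x : ℕ} (hx : x ∈ P.vars) : 2 ≤ x := by
  induction P with
  | skip | store => simp [vars] at hx
  | assign y e =>
    simp only [vars, List.mem_singleton] at hx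
    simp only [wf, Bool.and_eq_true, decide_eq_true_eq] at hP
    omega
  | seq P Q ihP ihQ =>
    simp only [wf, Bool.and_eq_true] at hP
    rcases List.mem_append.1 hx with h | h
    exacts [ihP hP.1 h, ihQ hP.2 h]
  | ite c P Q ihP ihQ =>
    simp only [wf, Bool.and_eq_true] at hP
    rcases List.mem_append.1 hx with h | h
    exacts [ihP hP.1.2 h, ihQ hP.2 h]
  | loop y z P ih =>
    simp only [wf, Bool.and_eq_true, decide_eq_true_eq] at hP
    rcases List.mem_cons.1 hx with h | h
    exacts [h ▸ hP.1.1.1, ih hP.2 h]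

/-- The translation of a loop program runs in time polynomial in the loop bounds, and the binary
lengths grow by at most a polynomial in them. -/
theorem exec_compile (P : LProg) (hP : P.wf = true) {N k L : ℕ} {σ : State} (hσ : σ.Bounded k)
    (h0 : σ.var 0 ≤ N) (h1 : σ.var 1 ≤ N) (hL : k + P.bound.eval N < L) :
    (P.run σ).Bounded (k + P.bound.eval N) ∧
      ∃ t ≤ P.bound.eval N, Exec L P.compile σ t (P.run σ) := by
  induction P generalizing k σ with
  | skip =>
    refine ⟨hσ.mono (by omega), 1, ?_, .skip σ⟩
    simp [bound]
  | assign x e =>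
    simp only [wf, Bool.and_eq_true] at hP
    simp only [bound, Polynomial.eval_C] at hL ⊢
    refine ⟨(hσ.mono (by omega)).setVar x ((e.natAbs_eval_le hσ hP.2).trans
      (Nat.pow_le_pow_right two_pos (by omega))), e.cost + 1, ?_,
      .assign σ x e (e.fits hσ hP.2 (by omega))⟩
    have := e.cost_le_weight
    omega
  | store a i e =>
    simp only [wf, Bool.and_eq_true] at hP
    simp only [bound, Polynomial.eval_C] at hL ⊢
    refine ⟨(hσ.mono (by omega)).setArr a _ ((e.natAbs_eval_le hσ hP.2).trans
      (Nat.pow_le_pow_right two_pos (by omega))), i.cost + e.cost + 1, ?_,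
      .store σ a i e (i.fits hσ hP.1 (by omega)) (e.fits hσ hP.2 (by omega))⟩
    have := e.cost_le_weight; have := i.cost_le_weight
    omega
  | seq P Q ihP ihQ =>
    simp only [wf, Bool.and_eq_true] at hP
    simp only [bound, Polynomial.eval_add] at hL ⊢
    obtain ⟨hb, s, hs, hPe⟩ := ihP hP.1 hσ h0 h1 (by omega)
    have e0 : (P.run σ).var 0 = σ.var 0 :=
      run_var (fun h => absurd (two_le_of_mem_vars hP.1 h) (by omega)) σ
    have e1 : (P.run σ).var 1 = σ.var 1 :=
      run_var (fun h => absurd (two_le_of_mem_vars hP.1 h) (by omega)) σ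
    obtain ⟨hb', t, ht, hQe⟩ := ihQ hP.2 hb (e0 ▸ h0) (e1 ▸ h1) (by omega)
    exact ⟨hb'.mono (by omega), s + t, by omega, .seq hPe hQe⟩
  | ite c P Q ihP ihQ =>
    simp only [wf, Bool.and_eq_true] at hP
    simp only [bound, Polynomial.eval_add, Polynomial.eval_C] at hL ⊢
    have hcf : c.Fits L σ := c.fits hσ hP.1.1 (by omega)
    have hcw := c.cost_le_weight
    by_cases hc : c.Holds σ
    · obtain ⟨hb, s, hs, hPe⟩ := ihP hP.1.2 hσ h0 h1 (by omega)
      simp only [run, hc, if_true]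
      exact ⟨hb.mono (by omega), c.cost + 1 + s, by omega, .ite_true hcf hc hPe⟩
    · obtain ⟨hb, s, hs, hQe⟩ := ihQ hP.2 hσ h0 h1 (by omega)
      simp only [run, hc, if_false]
      exact ⟨hb.mono (by omega), c.cost + 1 + s, by omega, .ite_false hcf hc hQe⟩
  | loop x y P ih =>
    simp only [wf, Bool.and_eq_true, decide_eq_true_eq] at hP
    obtain ⟨⟨⟨hx, hy⟩, hxP⟩, hPw⟩ := hP
    simp only [bound, Polynomial.eval_add, Polynomial.eval_C, Polynomial.eval_mul,
      Polynomial.eval_X] at hL ⊢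
    set B := P.bound.eval N with hB
    set K := (σ.var y).toNat with hK
    have hKN : K ≤ N := by
      have : σ.var y ≤ N := by interval_cases y <;> assumption
      omega
    -- The counter never exceeds a number that was in the memory at the start, so it does not
    -- contribute to the growth.
    have hKk : K ≤ 2 ^ k := le_trans (by omega) (hσ.1 y)
    have hmul : ∀ i ≤ N, i * (B + 8) ≤ N * (B + 8) := fun i hi => Nat.mul_le_mul_right _ hi
    have hag : ∀ i z, z ≠ x → z ∉ P.vars → (iter x P σ i).var z = σ.var z := fun i z hz hzP =>
      (iter_agree P.run_agree σ i).1 z (by simp [hz, hzP])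
    have hlow : ∀ i z, z < 2 → (iter x P σ i).var z = σ.var z := fun i z hz =>
      hag i z (by omega) (fun h => absurd (two_le_of_mem_vars hPw h) (by omega))
    -- Growth is additive in the exponent: each round contributes at most `B + 8`, whatever happened
    -- before.
    have hbd : ∀ i ≤ K, (iter x P σ i).Bounded (k + i * (B + 8)) := by
      intro i hi
      induction i with
      | zero => exact (hσ.mono (by omega)).setVar x (by simp)
      | succ i ihi =>
        have e : (i + 1) * (B + 8) = i * (B + 8) + B + 8 := by ring
        have hm := hmul (i + 1) (by omega)
        have hi' := (ih hPw (ihi (by omega)) (hlow i 0 (by omega) ▸ h0)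
          (hlow i 1 (by omega) ▸ h1) (by omega)).1
        rw [iter_succ]
        refine (hi'.mono (by omega)).setVar x ?_
        have h2 : 2 ^ k ≤ 2 ^ (k + (i + 1) * (B + 8)) := Nat.pow_le_pow_right two_pos (by omega)
        simp only [Int.natAbs_natCast]
        omega
    have hfit : ∀ i ≤ K, (Test.lt (.var x) (.var y)).Fits L (iter x P σ i) := by
      intro i hi
      have hm := hmul i (by omega)
      exact Test.fits (hbd i hi) _ rfl (by simp only [Test.weight, Expr.weight]; omega)
    -- The induction is on the number `j` of rounds left, since `Exec.while_true` splits off the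
    -- first round whereas `iter` adds the last one.
    have hwhile : ∀ j i, i + j = K → ∃ t ≤ 4 + j * (B + 8), Exec L
        (.while (.lt (.var x) (.var y)) (.seq P.compile (.assign x (.add (.var x) (.const 1)))))
        (iter x P σ i) t (iter x P σ K) := by
      intro j
      induction j with
      | zero =>
        intro i hi
        rw [show i = K by omega]
        refine ⟨4, by omega, .while_false (hfit K le_rfl) ?_⟩
        simp only [Test.Holds, Expr.eval, iter_var, hlow K y hy]
        omega
      | succ j ihj =>
        intro i hi
        obtain ⟨t, ht, hE⟩ := ihj (i + 1) (by omega)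
        have e : (i + 1) * (B + 8) = i * (B + 8) + B + 8 := by ring
        have e' : (j + 1) * (B + 8) = j * (B + 8) + B + 8 := by ring
        have hm := hmul (i + 1) (by omega)
        obtain ⟨hb, s, hs, hPe⟩ := ih hPw (hbd i (by omega)) (hlow i 0 (by omega) ▸ h0)
          (hlow i 1 (by omega) ▸ h1) (by omega)
        have hass := Exec.assign (L := L) (P.run (iter x P σ i)) x (.add (.var x) (.const 1))
          (Expr.fits hb _ rfl (by simp only [Expr.weight, Int.natAbs_one]; omega))
        have hst : (P.run (iter x P σ i)).setVar x
            ((Expr.add (.var x) (.const 1)).eval (P.run (iter x P σ i))) = iter x P σ (i + 1) := by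
          simp [Expr.eval, run_var hxP, iter_var, iter_succ]
        rw [hst] at hass
        refine ⟨_, ?_, .while_true (hfit i (by omega)) ?_ (.seq hPe hass) hE⟩
        · simp only [Test.cost, Expr.cost]
          omega
        · simp only [Test.Holds, Expr.eval, iter_var, hlow i y hy]
          omega
    obtain ⟨t, ht, hE⟩ := hwhile K 0 (by omega)
    have hm := hmul K hKN
    refine ⟨(hbd K le_rfl).mono (by omega), 2 + t, by omega, ?_⟩
    exact .seq (.assign σ x (.const 0) (Expr.fits hσ _ rfl (by
      simp only [Expr.weight, Int.natAbs_zero]; omega))) hE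

end LProg

end RAM

/-! ### From loop programs to strongly polynomial time. -/

namespace BMatchingInstance

theorem bounded_input (x : BMatchingInstance) : x.input.Bounded x.size := by
  have hlt : ∀ k ≤ x.size, k ≤ 2 ^ x.size := fun k hk => hk.trans Nat.lt_two_pow_self.le
  have hn : x.n ≤ x.size := by unfold size; omega
  have hm : x.m ≤ x.size := by unfold size; omega
  have htab : ∀ {k : ℕ} (f : Fin k → ℤ), (∀ j, (f j).natAbs ≤ 2 ^ x.size) → ∀ i,
      (tabulate f i).natAbs ≤ 2 ^ x.size := by
    intro k f hf i
    unfold tabulate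
    split_ifs
    · exact hf _
    · simp
  refine ⟨fun z => ?_, fun a i => ?_⟩
  · match z with
    | 0 => simpa [input] using hlt _ hn
    | 1 => simpa [input] using hlt _ hm
    | z + 2 => simp [input]
  · match a with
    | 0 =>
      change (tabulate (fun v => (x.b v : ℤ)) i).natAbs ≤ _
      refine htab _ (fun v => ?_) i
      simp only [Int.natAbs_natCast]
      have h1 : x.b v < 2 ^ (x.b v).size := Nat.lt_size_self _
      refine h1.le.trans (Nat.pow_le_pow_right two_pos ?_)
      have := Finset.single_le_sum (f := fun v => (x.b v).size) (fun _ _ => Nat.zero_le _)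
        (Finset.mem_univ v)
      unfold size; omega
    | 1 =>
      change (tabulate (fun v => if x.G.color v = true then 1 else 0) i).natAbs ≤ _
      refine htab _ (fun v => ?_) i
      have := Nat.one_le_two_pow (n := x.size)
      split_ifs <;> simp [this]
    | 2 =>
      change (tabulate (fun e => ((x.G.endA e : ℕ) : ℤ)) i).natAbs ≤ _
      exact htab _ (fun e => hlt _ (by have := (x.G.endA e).2; omega)) i
    | 3 =>
      change (tabulate (fun e => ((x.G.endB e : ℕ) : ℤ)) i).natAbs ≤ _
      exact htab _ (fun e => hlt _ (by have := (x.G.endB e).2; omega)) i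
    | a + 4 => simp [input]

/-- A problem that is solved by a loop program is solvable in strongly polynomial time. -/
theorem stronglyPolynomialTime_of_run (P : RAM.LProg) (hP : P.wf = true)
    (Solves : BMatchingInstance → RAM.State → Prop) (h : ∀ x, Solves x (P.run x.input)) :
    RAM.StronglyPolynomialTime dim size input Solves := by
  -- The input is bounded by `2 ^ size` and the exponent grows by at most `P.bound`; the additional
  -- 1 turns `≤` into the strict inequality in `Exec`. Time is measured by `P.bound` at `dim`, which
  -- ignores `b`.
  refine ⟨P.compile, P.bound, .X + P.bound + 1, fun x => ?_⟩
  have hds : x.dim ≤ x.size := by unfold dim size; omega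
  have hmono : P.bound.eval x.dim ≤ P.bound.eval x.size := by
    simp only [Polynomial.eval_eq_sum, Polynomial.sum]
    exact Finset.sum_le_sum fun i _ => Nat.mul_le_mul_left _ (Nat.pow_le_pow_left hds i)
  have h0 : x.input.var 0 = (x.n : ℤ) := rfl
  have h1 : x.input.var 1 = (x.m : ℤ) := rfl
  obtain ⟨_, t, ht, hE⟩ := P.exec_compile hP (N := x.dim)
    (L := (Polynomial.X + P.bound + 1 : Polynomial ℕ).eval x.size) x.bounded_input
    (by rw [h0]; unfold dim; push_cast; omega) (by rw [h1]; unfold dim; push_cast; omega) (by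
      simp only [Polynomial.eval_add, Polynomial.eval_X, Polynomial.eval_one]; omega)
  exact ⟨t, _, hE, ht, h x⟩

end BMatchingInstance

/-! ### Invariants for counting loops. -/

namespace RAM

@[simp] theorem State.setVar_var (σ : State) (x y : ℕ) (z : ℤ) :
    (σ.setVar x z).var y = if y = x then z else σ.var y := by
  simp [State.setVar, Function.update_apply]

@[simp] theorem State.setVar_arr (σ : State) (x : ℕ) (z : ℤ) : (σ.setVar x z).arr = σ.arr := rfl

@[simp] theorem State.setArr_var (σ : State) (a : ℕ) (i z : ℤ) : (σ.setArr a i z).var = σ.var := rfl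

@[simp] theorem State.setArr_arr (σ : State) (a c : ℕ) (i j z : ℤ) :
    (σ.setArr a i z).arr c j = if c = a ∧ j = i then z else σ.arr c j := by
  by_cases hc : c = a
  · subst hc; simp [State.setArr, Function.update_apply]
  · simp [State.setArr, hc]

namespace LProg

theorem Agree.trans {vs as vs' as' : List ℕ} {σ τ ρ : State} (h : Agree vs as σ τ)
    (h' : Agree vs' as' τ ρ) : Agree (vs ++ vs') (as ++ as') σ ρ := by
  refine ⟨fun x hx => ?_, fun a ha => ?_⟩
  · rw [List.mem_append, not_or] at hx
    exact (h'.1 x hx.2).trans (h.1 x hx.1)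
  · rw [List.mem_append, not_or] at ha
    exact (h'.2 a ha.2).trans (h.2 a ha.1)

/-- The counter is reassigned between rounds, so the invariant must not depend on it; this is `hI`.
In each round the body may use that everything not written by the loop still has its initial
content. -/
theorem loop_induction {x y k : ℕ} {P : LProg} {σ : State} (hk : σ.var y = k)
    (I : ℕ → State → Prop) (hI : ∀ i s z, I i s → I i (s.setVar x z)) (h0 : I 0 σ)
    (hstep : ∀ (i : Fin k) (s : State), s.var x = (i : ℕ) → Agree (x :: P.vars) P.arrs σ s →
      I i s → I (i + 1) (P.run s)) : I k ((loop x y P).run σ) := by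
  rw [run_loop, hk, Int.toNat_natCast]
  suffices ∀ i ≤ k, I i (iter x P σ i) from this k le_rfl
  intro i hi
  induction i with
  | zero => exact hI _ _ _ h0
  | succ i ih =>
    exact hI _ _ _ (hstep ⟨i, hi⟩ _ (iter_var x P σ i) (iter_agree P.run_agree σ i)
      (ih (by omega)))

/-- Round `i` writes no cell of `a` other than cell `i`, so what it establishes there persists to
the end. -/
theorem loop_fill {x y k a : ℕ} {P : LProg} {σ : State} (hk : σ.var y = k) (Q : Fin k → ℤ → Prop)
    (h : ∀ (i : Fin k) (s : State), s.var x = (i : ℕ) → Agree (x :: P.vars) P.arrs σ s →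
      Q i ((P.run s).arr a (i : ℕ)) ∧ ∀ j, j ≠ ((i : ℕ) : ℤ) → (P.run s).arr a j = s.arr a j)
    (i : Fin k) : Q i (((loop x y P).run σ).arr a (i : ℕ)) := by
  refine loop_induction hk (fun j s => ∀ i : Fin k, (i : ℕ) < j → Q i (s.arr a (i : ℕ)))
    (fun _ _ _ h => h) (fun i hi => absurd hi (by omega)) ?_ i i.2
  intro j s hs hag hQ i hi
  by_cases hij : i = j
  · subst hij; exact (h i s hs hag).1
  · rw [(h j s hs hag).2 _ (by simpa using fun e => hij (Fin.ext e))]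
    exact hQ i (by have := fun e => hij (Fin.ext e); omega)

/-- Count the values of the loop counter `x` that pass the test, in the variable `c`. -/
def count (c x y : ℕ) (t : Test) : LProg :=
  seq (assign c (.const 0)) (loop x y (ite t (assign c (.add (.var c) (.const 1))) skip))

/-- The test is evaluated in intermediate memories, hence `ht` has to cover all memories that differ
from the initial one in `c` and `x` only. -/
theorem run_count {c x y k : ℕ} {t : Test} {σ : State} (hk : σ.var y = k) (hcy : y ≠ c)
    (hcx : c ≠ x) (p : Fin k → Prop) [DecidablePred p]
    (ht : ∀ (i : Fin k) (s : State), s.var x = (i : ℕ) → Agree [c, x] [] σ s →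
      (t.Holds s ↔ p i)) :
    ((count c x y t).run σ).var c = (Finset.univ.filter p).card := by
  have key := loop_induction (x := x) (y := y) (k := k)
    (P := ite t (assign c (.add (.var c) (.const 1))) skip) (σ := σ.setVar c 0)
    (by simp [hcy, hk])
    (fun j s => s.var c = ((Finset.univ.filter fun i : Fin k => (i : ℕ) < j ∧ p i).card : ℤ))
    (by intro i s z h; simpa [hcx] using h) (by simp) (by
      intro i s hs hag hI
      have hag' : Agree [c, x] [] σ s := by
        refine ⟨fun z hz => ?_, fun a _ => hag.2 a (by simp [arrs])⟩
        simp only [List.mem_cons, List.not_mem_nil, or_false, not_or] at hz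
        rw [hag.1 z (by simp [vars, hz])]
        simp [hz]
      have hp := ht i s hs hag'
      by_cases hpi : p i
      · have hset : (Finset.univ.filter fun j : Fin k => (j : ℕ) < i + 1 ∧ p j) =
            insert i (Finset.univ.filter fun j : Fin k => (j : ℕ) < i ∧ p j) := by
          ext j
          simp only [Finset.mem_filter, Finset.mem_univ, true_and, Finset.mem_insert, Fin.ext_iff]
          constructor
          · rintro ⟨h1, h2⟩
            by_cases hj : (j : ℕ) = i
            · exact Or.inl hj
            · exact Or.inr ⟨by omega, h2⟩
          · rintro (h | h)
            · rw [Fin.ext h]; exact ⟨by omega, hpi⟩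
            · exact ⟨by omega, h.2⟩
        rw [hset, Finset.card_insert_of_notMem (by simp)]
        simp [run, hp.2 hpi, Expr.eval, hI]
      · have hset : (Finset.univ.filter fun j : Fin k => (j : ℕ) < i + 1 ∧ p j) =
            (Finset.univ.filter fun j : Fin k => (j : ℕ) < i ∧ p j) := by
          ext j
          simp only [Finset.mem_filter, Finset.mem_univ, true_and]
          refine and_congr_left fun hj => ⟨fun h => ?_, fun h => by omega⟩
          have : (j : ℕ) ≠ i := fun h => hpi (Fin.ext h ▸ hj)
          omega
        rw [hset]
        simp [run, mt hp.1 hpi, hI])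
  have hfin : (Finset.univ.filter fun i : Fin k => (i : ℕ) < k ∧ p i) = Finset.univ.filter p := by
    ext i; simp
  rw [hfin] at key
  exact key

/-- Store the truth value of a test. -/
def storeTest (a : ℕ) (i : Expr) (t : Test) : LProg :=
  ite t (store a i (.const 1)) (store a i (.const 0))

open Classical in
theorem run_storeTest (a : ℕ) (i : Expr) (t : Test) (σ : State) :
    (storeTest a i t).run σ = σ.setArr a (i.eval σ) (if t.Holds σ then 1 else 0) := by
  by_cases h : t.Holds σ <;> simp [storeTest, run, h, Expr.eval]

end LProg

end RAM

/-- The cells of a matrix with `m` columns in row-major order are distinct. -/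
theorem row_major_inj {m : ℕ} {i i' : ℕ} {j j' : Fin m} :
    ((i : ℤ) * m + (j : ℕ) = (i' : ℤ) * m + (j' : ℕ)) ↔ i = i' ∧ j = j' := by
  refine ⟨fun h => ?_, fun h => by rw [h.1, h.2]⟩
  have h' : i * m + j = i' * m + j' := by exact_mod_cast h
  have hm : 0 < m := j.pos
  have h1 := congrArg (· / m) h'
  have h2 := congrArg (· % m) h'
  simp only [Nat.mul_add_mod_of_lt j.2, Nat.mul_add_mod_of_lt j'.2] at h2
  have e1 : (i * m + j) / m = i := by
    rw [mul_comm, Nat.mul_add_div hm, Nat.div_eq_of_lt j.2, add_zero]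
  have e2 : (i' * m + j') / m = i' := by
    rw [mul_comm, Nat.mul_add_div hm, Nat.div_eq_of_lt j'.2, add_zero]
  have h3 : i = i' := by simpa [e1, e2] using h1
  subst h3
  exact ⟨rfl, Fin.ext (by omega)⟩

/-! ### Maximum `b`-matchings in a set of edges -/

namespace BipartiteGraph

section

variable {V E : Type*} [DecidableEq V] [DecidableEq E] (G : BipartiteGraph V E)

omit [DecidableEq E] in
-- Replaces the classical decidability instance in `degree` by the one at hand.
theorem degree_eq (M : Finset E) (v : V) :
    G.degree M v = (M.filter fun e => G.endA e = v ∨ G.endB e = v).card := by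
  unfold degree
  congr!

omit [DecidableEq E] in
theorem degree_mono {M N : Finset E} (h : M ⊆ N) (v : V) : G.degree M v ≤ G.degree N v := by
  rw [degree_eq, degree_eq]
  exact Finset.card_le_card (Finset.filter_subset_filter _ h)

theorem degree_insert {M : Finset E} {e : E} (he : e ∉ M) (v : V) :
    G.degree (insert e M) v = G.degree M v + if G.endA e = v ∨ G.endB e = v then 1 else 0 := by
  rw [degree_eq, degree_eq, Finset.filter_insert]
  split_ifs
  · rw [Finset.card_insert_of_notMem (by simp [he])]
  · rfl

theorem degree_erase {M : Finset E} {e : E} (he : e ∈ M) (v : V) :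
    G.degree (M.erase e) v + (if G.endA e = v ∨ G.endB e = v then 1 else 0) = G.degree M v := by
  rw [← G.degree_insert (Finset.notMem_erase e M) v, Finset.insert_erase he]

omit [DecidableEq V] [DecidableEq E] in
theorem endA_ne {e : E} {v : V} (h : G.color v = false) : G.endA e ≠ v := by
  rintro rfl; simp [G.color_endA] at h

omit [DecidableEq V] [DecidableEq E] in
theorem endB_ne {e : E} {v : V} (h : G.color v = true) : G.endB e ≠ v := by
  rintro rfl; simp [G.color_endB] at h

omit [DecidableEq E] in
-- Every edge has exactly one end in `A`, so the edges can be sorted by it; at a vertex of `A` the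
-- alternative `G.endB e = v` in the degree never occurs.
theorem card_filter_endA [Fintype V] (M : Finset E) (X : V → Prop) [DecidablePred X] :
    (M.filter fun e => X (G.endA e)).card =
      ∑ v ∈ Finset.univ.filter (fun v => G.color v = true ∧ X v), G.degree M v := by
  rw [Finset.card_eq_sum_card_fiberwise (f := G.endA)
    (t := Finset.univ.filter (fun v => G.color v = true ∧ X v))]
  · refine Finset.sum_congr rfl fun v hv => ?_
    simp only [Finset.mem_filter, Finset.mem_univ, true_and] at hv
    rw [degree_eq, Finset.filter_filter]
    congr 1
    refine Finset.filter_congr fun e _ => ?_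
    simp only [G.endB_ne hv.1, or_false, and_iff_right_iff_imp]
    rintro rfl
    exact hv.2
  · intro e he
    simp only [Finset.coe_filter, Set.mem_ofPred_eq] at he
    simp [he.2, G.color_endA]

omit [DecidableEq E] in
theorem card_filter_endB [Fintype V] (M : Finset E) (X : V → Prop) [DecidablePred X] :
    (M.filter fun e => X (G.endB e)).card =
      ∑ v ∈ Finset.univ.filter (fun v => G.color v = false ∧ X v), G.degree M v := by
  rw [Finset.card_eq_sum_card_fiberwise (f := G.endB)
    (t := Finset.univ.filter (fun v => G.color v = false ∧ X v))]
  · refine Finset.sum_congr rfl fun v hv => ?_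
    simp only [Finset.mem_filter, Finset.mem_univ, true_and] at hv
    rw [degree_eq, Finset.filter_filter]
    congr 1
    refine Finset.filter_congr fun e _ => ?_
    simp only [G.endA_ne hv.1, false_or, and_iff_right_iff_imp]
    rintro rfl
    exact hv.2
  · intro e he
    simp only [Finset.coe_filter, Set.mem_ofPred_eq] at he
    simp [he.2, G.color_endB]

/-- `M` is a largest `b`-matching among those contained in `S`. -/
def IsMaxIn (S : Finset E) (b : V → ℕ) (M : Finset E) : Prop :=
  M ⊆ S ∧ G.IsBMatching b M ∧ ∀ N ⊆ S, G.IsBMatching b N → N.card ≤ M.card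

omit [DecidableEq V] [DecidableEq E] in
theorem isMaxIn_univ [Fintype E] (b : V → ℕ) (M : Finset E) :
    G.IsMaxIn Finset.univ b M ↔ G.IsMaxBMatching b M := by
  simp [IsMaxIn, IsMaxBMatching]

omit [DecidableEq V] [DecidableEq E] in
theorem isBMatching_empty (b : V → ℕ) : G.IsBMatching b ∅ := fun v => by simp [degree]

/-- The search for an augmentation of the `b`-matching `M` in `S`: every vertex `v` that has been
reached comes with a modification `N v` of `M`, which is a `b`-matching of the same size that is
loose at `v` if `v` is in `A`, and one edge larger and within the degrees of `M` at the vertices of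
`B` other than `v` if `v` is in `B`. -/
structure SearchInv (S : Finset E) (b : V → ℕ) (M : Finset E) (R : V → Prop) (N : V → Finset E) :
    Prop where
  sub : ∀ v, R v → N v ⊆ S
  cardA : ∀ v, R v → G.color v = true → (N v).card = M.card
  cardB : ∀ v, R v → G.color v = false → (N v).card = M.card + 1
  degA : ∀ v w, R v → G.color w = true → G.degree (N v) w ≤ b w
  loose : ∀ v, R v → G.color v = true → G.degree (N v) v < b v
  degB : ∀ v w, R v → G.color w = false → w ≠ v → G.degree (N v) w ≤ G.degree M w
  -- At `v` itself the capacity may be exceeded by one. This is repaired when the search leaves `v`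
  -- by removing an edge, and does not occur if `v` is loose for `M`.
  degB' : ∀ v, R v → G.color v = false → G.degree (N v) v ≤ G.degree M v + 1
  -- Only edges with both ends reached have been changed. Hence the edge along which a new vertex is
  -- reached still has its status in `M`, and can be added or removed.
  same : ∀ v, R v → ∀ e, (¬ R (G.endA e) ∨ ¬ R (G.endB e)) → (e ∈ N v ↔ e ∈ M)

variable {G} {S M : Finset E} {b : V → ℕ} {R R' : V → Prop} {N N' : V → Finset E}

omit [DecidableEq V] [DecidableEq E] in
theorem SearchInv.init (hS : M ⊆ S) (hM : G.IsBMatching b M)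
    (hR : ∀ v, R v ↔ G.color v = true ∧ G.degree M v < b v) (hN : ∀ v, N v = M) :
    G.SearchInv S b M R N where
  sub v _ := hN v ▸ hS
  cardA v _ _ := by rw [hN]
  cardB v h h' := by simp [((hR v).1 h).1] at h'
  degA v w _ _ := hN v ▸ hM w
  loose v h _ := hN v ▸ ((hR v).1 h).2
  degB v w _ _ _ := by rw [hN]
  degB' v h h' := by simp [((hR v).1 h).1] at h'
  same v _ e _ := by rw [hN]

/-- The set of `G.endA e` is loose there, so it has room for `e`; the only vertex of `B` whose
degree grows is the new one. -/
theorem SearchInv.forward (h : G.SearchInv S b M R N) {e : E} (heS : e ∈ S) (heM : e ∉ M)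
    (hu : R (G.endA e)) (hv : ¬ R (G.endB e)) (hR : ∀ w, R' w ↔ R w ∨ w = G.endB e)
    (hN : ∀ w ≠ G.endB e, N' w = N w) (hN' : N' (G.endB e) = insert e (N (G.endA e))) :
    G.SearchInv S b M R' N' := by
  have hold : ∀ w, R w → N' w = N w := fun w hw => hN w (by rintro rfl; exact hv hw)
  have he : e ∉ N (G.endA e) := fun h' => heM ((h.same _ hu e (Or.inr hv)).1 h')
  have hcB := G.color_endB e
  have hcA := G.color_endA e
  constructor
  · intro v hv'
    rcases (hR v).1 hv' with hw | rfl
    · exact hold v hw ▸ h.sub v hw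
    · rw [hN']; exact Finset.insert_subset heS (h.sub _ hu)
  · intro v hv' hc
    rcases (hR v).1 hv' with hw | rfl
    · exact hold v hw ▸ h.cardA v hw hc
    · simp [hcB] at hc
  · intro v hv' hc
    rcases (hR v).1 hv' with hw | rfl
    · exact hold v hw ▸ h.cardB v hw hc
    · rw [hN', Finset.card_insert_of_notMem he, h.cardA _ hu hcA]
  · intro v w hv' hc
    rcases (hR v).1 hv' with hw | rfl
    · exact hold v hw ▸ h.degA v w hw hc
    · rw [hN', degree_insert _ he]
      by_cases hw : G.endA e = w
      · subst hw
        have := h.loose _ hu hcA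
        simp only [true_or, if_true]; omega
      · have := h.degA _ w hu hc
        simpa [hw, G.endB_ne hc] using this
  · intro v hv' hc
    rcases (hR v).1 hv' with hw | rfl
    · exact hold v hw ▸ h.loose v hw hc
    · simp [hcB] at hc
  · intro v w hv' hc hwv
    rcases (hR v).1 hv' with hw | rfl
    · exact hold v hw ▸ h.degB v w hw hc hwv
    · rw [hN', degree_insert _ he]
      have := h.degB _ w hu hc (by rintro rfl; simp [hcA] at hc)
      simpa [hwv.symm, G.endA_ne hc] using this
  · intro v hv' hc
    rcases (hR v).1 hv' with hw | rfl
    · exact hold v hw ▸ h.degB' v hw hc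
    · rw [hN', degree_insert _ he]
      have := h.degB _ _ hu hc (G.endA_ne hc).symm
      simpa using this
  · intro v hv' f hf
    have hf' : ¬ R (G.endA f) ∨ ¬ R (G.endB f) :=
      hf.imp (fun h1 h2 => h1 ((hR _).2 (.inl h2))) (fun h1 h2 => h1 ((hR _).2 (.inl h2)))
    rcases (hR v).1 hv' with hw | rfl
    · exact hold v hw ▸ h.same v hw f hf'
    · rw [hN', Finset.mem_insert, h.same _ hu f hf', or_iff_right]
      rintro rfl
      rcases hf with hf | hf
      · exact hf ((hR _).2 (.inl hu))
      · exact hf ((hR _).2 (.inr rfl))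

/-- The set of `G.endB e` has one surplus edge and possibly a surplus at `G.endB e`. Removing `e`
cancels both and makes the new vertex `G.endA e` loose. -/
theorem SearchInv.backward (h : G.SearchInv S b M R N) {e : E} (heM : e ∈ M)
    (hu : R (G.endB e)) (hv : ¬ R (G.endA e)) (hR : ∀ w, R' w ↔ R w ∨ w = G.endA e)
    (hN : ∀ w ≠ G.endA e, N' w = N w) (hN' : N' (G.endA e) = (N (G.endB e)).erase e) :
    G.SearchInv S b M R' N' := by
  have hold : ∀ w, R w → N' w = N w := fun w hw => hN w (by rintro rfl; exact hv hw)
  have he : e ∈ N (G.endB e) := (h.same _ hu e (Or.inl hv)).2 heM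
  have hcB := G.color_endB e
  have hcA := G.color_endA e
  have hdeg := G.degree_erase he
  constructor
  · intro v hv'
    rcases (hR v).1 hv' with hw | rfl
    · exact hold v hw ▸ h.sub v hw
    · rw [hN']; exact (Finset.erase_subset _ _).trans (h.sub _ hu)
  · intro v hv' hc
    rcases (hR v).1 hv' with hw | rfl
    · exact hold v hw ▸ h.cardA v hw hc
    · rw [hN', Finset.card_erase_of_mem he, h.cardB _ hu hcB]; rfl
  · intro v hv' hc
    rcases (hR v).1 hv' with hw | rfl
    · exact hold v hw ▸ h.cardB v hw hc
    · simp [hcA] at hc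
  · intro v w hv' hc
    rcases (hR v).1 hv' with hw | rfl
    · exact hold v hw ▸ h.degA v w hw hc
    · rw [hN']
      exact (G.degree_mono (Finset.erase_subset _ _) w).trans (h.degA _ w hu hc)
  · intro v hv' hc
    rcases (hR v).1 hv' with hw | rfl
    · exact hold v hw ▸ h.loose v hw hc
    · have h1 := hdeg (G.endA e)
      have h2 := h.degA _ _ hu hcA
      rw [hN']
      simp only [true_or, if_true] at h1
      omega
  · intro v w hv' hc hwv
    rcases (hR v).1 hv' with hw | rfl
    · exact hold v hw ▸ h.degB v w hw hc hwv
    · rw [hN']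
      by_cases hw : w = G.endB e
      · subst hw
        have h1 := hdeg (G.endB e)
        have h2 := h.degB' _ hu hcB
        simp only [or_true, if_true] at h1
        omega
      · exact (G.degree_mono (Finset.erase_subset _ _) w).trans (h.degB _ w hu hc hw)
  · intro v hv' hc
    rcases (hR v).1 hv' with hw | rfl
    · exact hold v hw ▸ h.degB' v hw hc
    · simp [hcA] at hc
  · intro v hv' f hf
    have hf' : ¬ R (G.endA f) ∨ ¬ R (G.endB f) :=
      hf.imp (fun h1 h2 => h1 ((hR _).2 (.inl h2))) (fun h1 h2 => h1 ((hR _).2 (.inl h2)))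
    rcases (hR v).1 hv' with hw | rfl
    · exact hold v hw ▸ h.same v hw f hf'
    · rw [hN', Finset.mem_erase, h.same _ hu f hf', and_iff_right]
      rintro rfl
      rcases hf with hf | hf
      · exact hf ((hR _).2 (.inr rfl))
      · exact hf ((hR _).2 (.inl hu))

omit [DecidableEq E] in
-- Together with `cardB` this is the augmentation: the extra edge at `v` is covered by the looseness
-- of `v` for `M`.
theorem SearchInv.isBMatching (h : G.SearchInv S b M R N) (hM : G.IsBMatching b M) {v : V}
    (hv : R v) (hc : G.color v = false) (hd : G.degree M v < b v) : G.IsBMatching b (N v) := by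
  intro w
  cases hw : G.color w
  · by_cases hwv : w = v
    · subst hwv; have := h.degB' w hv hc; omega
    · exact (h.degB v w hv hw hwv).trans (hM w)
  · exact h.degA v w hv hw

variable (G S M R) in
/-- The set of reached vertices cannot be extended along the edge `e` of `S`. -/
def ClosedAt (e : E) : Prop :=
  (e ∈ S → e ∉ M → R (G.endA e) → R (G.endB e)) ∧ (e ∈ M → R (G.endB e) → R (G.endA e))

/-- If the search cannot be continued and has found no augmentation, then `M` is maximum. -/
theorem isMaxIn_of_closed [Fintype V] (hS : M ⊆ S) (hM : G.IsBMatching b M)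
    (hsrc : ∀ v, G.color v = true → G.degree M v < b v → R v)
    (hcl : ∀ e, G.ClosedAt S M R e)
    (htgt : ∀ v, R v → G.color v = false → b v ≤ G.degree M v) : G.IsMaxIn S b M := by
  classical
  refine ⟨hS, hM, fun N hNS hN => ?_⟩
  -- For any `N`, the edges split into those with `A`-end outside of `R`, those ending in `R` within
  -- `B`, and those from `R` to the outside. The first two kinds are limited by capacities that `M`
  -- exhausts, and closedness puts all edges of `S` of the third kind into `M`. For `M` the count is
  -- exact, since its edges into `R` within `B` come from `R`.
  have h1 : (N.filter fun e => ¬ R (G.endA e)).card ≤ (M.filter fun e => ¬ R (G.endA e)).card := by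
    rw [G.card_filter_endA N (fun v => ¬ R v), G.card_filter_endA M (fun v => ¬ R v)]
    refine Finset.sum_le_sum fun v hv => (hN v).trans ?_
    simp only [Finset.mem_filter, Finset.mem_univ, true_and] at hv
    exact not_lt.1 fun h => hv.2 (hsrc v hv.1 h)
  have h2 : (N.filter fun e => R (G.endB e)).card ≤ (M.filter fun e => R (G.endB e)).card := by
    rw [G.card_filter_endB N R, G.card_filter_endB M R]
    refine Finset.sum_le_sum fun v hv => (hN v).trans ?_
    simp only [Finset.mem_filter, Finset.mem_univ, true_and] at hv
    exact htgt v hv.2 hv.1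
  have h3 : (N.filter fun e => R (G.endA e)).card ≤
      (N.filter fun e => R (G.endB e)).card +
        (M.filter fun e => R (G.endA e) ∧ ¬ R (G.endB e)).card := by
    refine le_trans (Finset.card_le_card ?_) (Finset.card_union_le _ _)
    intro e he
    simp only [Finset.mem_filter, Finset.mem_union] at he ⊢
    by_cases hB : R (G.endB e)
    · exact Or.inl ⟨he.1, hB⟩
    · refine Or.inr ⟨?_, he.2, hB⟩
      by_contra heM
      exact hB ((hcl e).1 (hNS he.1) heM he.2)
  have h4 : (M.filter fun e => R (G.endA e)).card =
      (M.filter fun e => R (G.endB e)).card +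
        (M.filter fun e => R (G.endA e) ∧ ¬ R (G.endB e)).card := by
    rw [← Finset.card_union_of_disjoint]
    · congr 1
      ext e
      simp only [Finset.mem_filter, Finset.mem_union]
      have := (hcl e).2
      tauto
    · rw [Finset.disjoint_filter]
      tauto
  have h5 := Finset.card_filter_add_card_filter_not (s := N) (fun e => R (G.endA e))
  have h6 := Finset.card_filter_add_card_filter_not (s := M) (fun e => R (G.endA e))
  omega

end

/-! ### The decomposition in terms of sizes of maximum `b`-matchings -/

section

variable {V E : Type*} [DecidableEq V] [DecidableEq E] [Fintype E] {G : BipartiteGraph V E}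
  {b b' : V → ℕ} {M M' : Finset E}

omit [DecidableEq E] in
-- The `b`-matchings that are loose at `v` are exactly the `b'`-matchings. Without `0 < b v` the
-- truncated subtraction would give `b' = b`, and the criterion would wrongly call `v` loose.
theorem mem_looseVertices_iff {v : V} (hM : G.IsMaxIn Finset.univ b M) (hv : 0 < b v)
    (hb' : ∀ w, b' w = if w = v then b w - 1 else b w) (hM' : G.IsMaxIn Finset.univ b' M') :
    v ∈ G.looseVertices b ↔ M'.card = M.card := by
  have hle : ∀ w, b' w ≤ b w := fun w => by rw [hb']; split_ifs <;> omega
  have hM'b : G.IsBMatching b M' := fun w => (hM'.2.1 w).trans (hle w)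
  have hcard := hM.2.2 M' (Finset.subset_univ _) hM'b
  constructor
  · rintro ⟨N, hN, hd⟩
    have h1 : G.IsBMatching b' N := fun w => by
      rw [hb']
      split_ifs with h
      · subst h; omega
      · exact hN.1 w
    have := hM'.2.2 N (Finset.subset_univ _) h1
    have := hN.2 M hM.2.1
    omega
  · intro h
    refine ⟨M', ⟨hM'b, fun N hN => h ▸ hM.2.2 N (Finset.subset_univ _) hN⟩, ?_⟩
    have := hM'.2.1 v
    rw [hb', if_pos rfl] at this
    omega

omit [DecidableEq V] [DecidableEq E] [Fintype E] in
theorem pos_of_mem_looseVertices {v : V} (h : v ∈ G.looseVertices b) : 0 < b v := by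
  obtain ⟨N, -, hd⟩ := h
  omega

omit [DecidableEq V] in
-- The sizes agree iff some maximum `b`-matching avoids `e`. That an inevitable edge is also allowed
-- needs the existence of a maximum `b`-matching, here `M`.
theorem inevitable_iff {e : E} (hM : G.IsMaxIn Finset.univ b M)
    (hM' : G.IsMaxIn (Finset.univ.erase e) b M') : G.Inevitable b e ↔ M'.card ≠ M.card := by
  have heM' : e ∉ M' := fun h => Finset.notMem_erase e _ (hM'.1 h)
  constructor
  · rintro ⟨-, h⟩ hc
    exact heM' (h M' ⟨hM'.2.1, fun N hN => hc ▸ hM.2.2 N (Finset.subset_univ _) hN⟩)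
  · intro hc
    have key : ∀ N, G.IsMaxBMatching b N → e ∈ N := by
      intro N hN
      by_contra he
      have h1 := hM'.2.2 N (fun f hf => by
        simp only [Finset.mem_erase, Finset.mem_univ, and_true]
        rintro rfl; exact he hf) hN.1
      have h2 := hM.2.2 M' (Finset.subset_univ _) hM'.2.1
      have h3 := hN.2 M hM.2.1
      omega
    have hMM := (G.isMaxIn_univ b M).1 hM
    exact ⟨⟨M, hMM, key M hMM⟩, key⟩

omit [Fintype E] in
theorem pos_of_allowed {e : E} (h : G.Allowed b e) : 0 < b (G.endA e) ∧ 0 < b (G.endB e) := by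
  obtain ⟨N, hN, he⟩ := h
  have h1 := G.degree_erase he (G.endA e)
  have h2 := G.degree_erase he (G.endB e)
  have h3 := hN.1 (G.endA e)
  have h4 := hN.1 (G.endB e)
  simp only [true_or, or_true, if_true] at h1 h2
  omega

/-- Removing and inserting `e` translates between `b`-matchings that contain `e` and `b'`-matchings
that avoid it, with sizes differing by one. Positivity at both ends makes the insertion legitimate
despite truncated subtraction. -/
theorem allowed_iff {e : E} (hM : G.IsMaxIn Finset.univ b M) (hA : 0 < b (G.endA e))
    (hB : 0 < b (G.endB e))
    (hb' : ∀ w, b' w = if G.endA e = w ∨ G.endB e = w then b w - 1 else b w)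
    (hM' : G.IsMaxIn (Finset.univ.erase e) b' M') :
    G.Allowed b e ↔ M'.card + 1 = M.card := by
  have heM' : e ∉ M' := fun h => Finset.notMem_erase e _ (hM'.1 h)
  have hins : G.IsBMatching b (insert e M') := by
    intro w
    have h1 := hM'.2.1 w
    rw [hb'] at h1
    rw [G.degree_insert heM']
    split_ifs at h1 ⊢ with h
    · have : 0 < b w := by rcases h with rfl | rfl <;> assumption
      omega
    · exact h1
  have hcard := hM.2.2 _ (Finset.subset_univ _) hins
  rw [Finset.card_insert_of_notMem heM'] at hcard
  constructor
  · rintro ⟨N, hN, he⟩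
    have h1 : G.IsBMatching b' (N.erase e) := by
      intro w
      have h2 := G.degree_erase he w
      have h3 := hN.1 w
      rw [hb']
      split_ifs at h2 ⊢ <;> omega
    have h2 := hM'.2.2 _ (Finset.erase_subset_erase e (Finset.subset_univ N)) h1
    rw [Finset.card_erase_of_mem he] at h2
    have h3 := hN.2 M hM.2.1
    omega
  · intro h
    refine ⟨insert e M', ⟨hins, fun N hN => ?_⟩, Finset.mem_insert_self _ _⟩
    rw [Finset.card_insert_of_notMem heM', h]
    exact hM.2.2 N (Finset.subset_univ _) hN

end

/-! ### Flexible components, their order as reachability, and inconsistency. -/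

section

variable {V E : Type*} {G : BipartiteGraph V E} {b : V → ℕ}

theorem between_singleton {u v : V} {e : E} :
    G.Between {u} {v} e ↔ (G.endA e = u ∧ G.endB e = v) ∨ (G.endB e = u ∧ G.endA e = v) := Iff.rfl

theorem flexAdj_symm {u v : V} (h : G.FlexAdj b u v) : G.FlexAdj b v u := by
  obtain ⟨e, he, h⟩ := h
  refine ⟨e, he, ?_⟩
  rw [between_singleton] at h ⊢
  tauto

theorem mem_flexComp_self (v : V) : v ∈ G.flexComp b v := Relation.ReflTransGen.refl

theorem mem_flexComp_symm {u v : V} (h : u ∈ G.flexComp b v) : v ∈ G.flexComp b u :=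
  haveI : Std.Symm (G.FlexAdj b) := ⟨fun _ _ => flexAdj_symm⟩
  Relation.ReflTransGen.stdSymm.symm _ _ h

theorem flexComp_eq_iff {u v : V} : G.flexComp b u = G.flexComp b v ↔ v ∈ G.flexComp b u := by
  constructor
  · intro h; rw [h]; exact mem_flexComp_self v
  · intro h
    ext w
    exact ⟨fun hw => (mem_flexComp_symm h).trans hw, fun hw => Relation.ReflTransGen.trans h hw⟩

/-- An allowed edge uses up a unit of capacity at both ends, so no flexible edge meets a vertex of
value 0. -/
theorem flexComp_eq_singleton {v : V} [DecidableEq V] [DecidableEq E] [Fintype E]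
    (hv : b v = 0) : G.flexComp b v = {v} := by
  ext w
  refine ⟨fun h => ?_, fun h => by
    rw [Set.mem_singleton_iff.1 h]; exact mem_flexComp_self v⟩
  rcases Relation.ReflTransGen.cases_head h with h | ⟨u, ⟨e, he, hb⟩, -⟩
  · exact h.symm
  · have := pos_of_allowed he.1
    rw [between_singleton] at hb
    rcases hb with ⟨rfl, -⟩ | ⟨rfl, -⟩ <;> omega

variable (G b) in
/-- The arcs on the vertices that generate the order on the flexible components. -/
def Arc (u v : V) : Prop :=
  ∃ e, (G.endA e = u ∧ G.endB e = v ∧ G.Allowed b e) ∨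
    (G.endB e = u ∧ G.endA e = v ∧ ¬ G.Inevitable b e)

theorem Arc.of_flexAdj {u v : V} (h : G.FlexAdj b u v) : G.Arc b u v := by
  obtain ⟨e, he, h⟩ := h
  rw [between_singleton] at h
  refine ⟨e, h.imp (fun h => ⟨h.1, h.2, he.1⟩) (fun h => ⟨h.1, h.2, he.2⟩)⟩

theorem between_classA {C D : Set V} {e : E} :
    G.Between (C ∩ G.A) (D ∩ G.Aᶜ) e ↔ G.endA e ∈ C ∧ G.endB e ∈ D := by
  simp [Between, A, G.color_endA, G.color_endB]

theorem flexCompOf_eq_of_flexAdj {u v : V} (h : G.FlexAdj b u v) :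
    G.flexCompOf b u = G.flexCompOf b v :=
  Subtype.ext (flexComp_eq_iff.2 (Relation.ReflTransGen.single h))

/-- The order on the flexible components is reachability in the arcs on the vertices. -/
theorem flexLE_iff {u v : V} :
    G.FlexLE b G.A (G.flexCompOf b u) (G.flexCompOf b v) ↔ Relation.ReflTransGen (G.Arc b) u v := by
  constructor
  -- Flexible adjacency is symmetric and consists of arcs, so any two vertices of a component reach
  -- each other.
  · have hcomp : ∀ {p q w : V}, p ∈ G.flexComp b w → q ∈ G.flexComp b w →
        Relation.ReflTransGen (G.Arc b) p q := fun hp hq =>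
      Relation.ReflTransGen.mono (fun _ _ => Arc.of_flexAdj) _ _
        (Relation.ReflTransGen.trans (mem_flexComp_symm hp) hq)
    suffices ∀ D, G.FlexLE b G.A (G.flexCompOf b u) D → ∀ w ∈ D.1,
        Relation.ReflTransGen (G.Arc b) u w from fun h => this _ h v (mem_flexComp_self v)
    intro D hD
    induction hD with
    | refl => exact fun w hw => hcomp (mem_flexComp_self u) hw
    | @tail C D _ hCD ih =>
      obtain ⟨-, d, rfl⟩ := D
      rcases hCD with rfl | ⟨e, he, hb⟩ | ⟨e, he, hb⟩
      · exact ih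
      · rw [between_classA] at hb
        exact fun w hw => ((ih _ hb.1).tail ⟨e, Or.inl ⟨rfl, rfl, he.1⟩⟩).trans (hcomp hb.2 hw)
      · rw [between_classA] at hb
        exact fun w hw => ((ih _ hb.2).tail ⟨e, Or.inr ⟨rfl, rfl, fun h => he h.1⟩⟩).trans
          (hcomp hb.1 hw)
  · intro h
    induction h with
    | refl => exact .refl
    | @tail p q _ hpq ih =>
      refine ih.tail ?_
      obtain ⟨e, ⟨hp, hq, he⟩ | ⟨hp, hq, he⟩⟩ := hpq
      -- An allowed edge is inevitable, which gives a generating pair, or flexible, in which case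
      -- the component does not change. Dually, an edge that is not inevitable is forbidden or
      -- flexible.
      · by_cases hi : G.Inevitable b e
        · refine Or.inr (Or.inl ⟨e, hi, between_classA.2 ?_⟩)
          rw [hp, hq]; exact ⟨mem_flexComp_self p, mem_flexComp_self q⟩
        · exact Or.inl (flexCompOf_eq_of_flexAdj ⟨e, ⟨he, hi⟩, Or.inl ⟨hp, hq⟩⟩)
      · by_cases ha : G.Allowed b e
        · exact Or.inl (flexCompOf_eq_of_flexAdj ⟨e, ⟨ha, he⟩, Or.inr ⟨hp, hq⟩⟩)
        · refine Or.inr (Or.inr ⟨e, ha, between_classA.2 ?_⟩)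
          rw [hp, hq]; exact ⟨mem_flexComp_self q, mem_flexComp_self p⟩

variable [DecidableEq V] [DecidableEq E] [Fintype E]

/-- A vertex of value 0 forms a component by itself and is never loose. Hence the single-vertex
condition and the requirement in `neighbors` to be outside of the set are both automatic. -/
theorem inconsistentHookedBy_iff (W : Set V) (v : V) :
    G.InconsistentHookedBy b W (G.flexComp b v) ↔
      (∃ u ∈ G.flexComp b v, u ∈ G.looseVertices b ∧ u ∈ W) ∨
        (b v = 0 ∧ ∃ e, G.Between {v} (G.looseVertices b ∩ W) e) := by
  unfold InconsistentHookedBy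
  refine or_congr ⟨fun ⟨u, h⟩ => ⟨u, h.1.1, h.1.2, h.2⟩, fun ⟨u, h1, h2, h3⟩ => ⟨u, ⟨h1, h2⟩, h3⟩⟩ ?_
  constructor
  · rintro ⟨w, hw, hb, -, he⟩
    have : v = w := by
      have := mem_flexComp_self (G := G) (b := b) v
      rwa [hw] at this
    subst this
    exact ⟨hb, he⟩
  · rintro ⟨hb, he⟩
    exact ⟨v, flexComp_eq_singleton hb, hb,
      fun h => by have := pos_of_mem_looseVertices h.1; omega, he⟩

theorem inconsistentHookedBy_A_iff (v : V) :
    G.InconsistentHookedBy b G.A (G.flexComp b v) ↔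
      (∃ u, u ∈ G.flexComp b v ∧ u ∈ G.looseVertices b ∧ G.color u = true) ∨
        (∃ e, b v = 0 ∧ G.endB e = v ∧ G.endA e ∈ G.looseVertices b) := by
  rw [inconsistentHookedBy_iff]
  simp [Between, A, G.color_endA, G.color_endB]

theorem inconsistentHookedBy_B_iff (v : V) :
    G.InconsistentHookedBy b G.B (G.flexComp b v) ↔
      (∃ u, u ∈ G.flexComp b v ∧ u ∈ G.looseVertices b ∧ G.color u = false) ∨
        (∃ e, b v = 0 ∧ G.endA e = v ∧ G.endB e ∈ G.looseVertices b) := by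
  rw [inconsistentHookedBy_iff]
  simp [Between, B, G.color_endA, G.color_endB]

/-- Inconsistency is the case in which `W` is the set of all vertices, and every loose vertex has
one of the two colors. -/
theorem inconsistent_iff (v : V) :
    G.Inconsistent b (G.flexComp b v) ↔ G.InconsistentHookedBy b G.A (G.flexComp b v) ∨
      G.InconsistentHookedBy b G.B (G.flexComp b v) := by
  have huniv : G.Inconsistent b (G.flexComp b v) ↔
      G.InconsistentHookedBy b Set.univ (G.flexComp b v) := by
    simp [Inconsistent, InconsistentHookedBy]
  have hcol : ∀ w : V, w ∈ G.A ∨ w ∈ G.B := fun w => by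
    cases h : G.color w <;> simp [A, B, h]
  rw [huniv]
  simp only [inconsistentHookedBy_iff, Between, Set.mem_inter_iff, Set.mem_univ, and_true]
  constructor
  · rintro (⟨u, hu, hl⟩ | ⟨hb, e, ⟨h1, h2⟩ | ⟨h1, h2⟩⟩)
    · exact (hcol u).imp (fun h => .inl ⟨u, hu, hl, h⟩) (fun h => .inl ⟨u, hu, hl, h⟩)
    · exact (hcol (G.endB e)).imp (fun h => .inr ⟨hb, e, .inl ⟨h1, h2, h⟩⟩)
        (fun h => .inr ⟨hb, e, .inl ⟨h1, h2, h⟩⟩)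
    · exact (hcol (G.endA e)).imp (fun h => .inr ⟨hb, e, .inr ⟨h1, h2, h⟩⟩)
        (fun h => .inr ⟨hb, e, .inr ⟨h1, h2, h⟩⟩)
  · rintro ((⟨u, hu, hl, -⟩ | ⟨hb, e, h⟩) | (⟨u, hu, hl, -⟩ | ⟨hb, e, h⟩))
    · exact .inl ⟨u, hu, hl⟩
    · exact .inr ⟨hb, e, h.imp (fun h => ⟨h.1, h.2.1⟩) (fun h => ⟨h.1, h.2.1⟩)⟩
    · exact .inl ⟨u, hu, hl⟩
    · exact .inr ⟨hb, e, h.imp (fun h => ⟨h.1, h.2.1⟩) (fun h => ⟨h.1, h.2.1⟩)⟩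

end

end BipartiteGraph

/-! ### A loop program for maximum `b`-matchings -/

namespace RAM.LProg

/-- Sequential composition. -/
infixr:35 " ;; " => LProg.seq

end RAM.LProg

namespace BMatchingInstance

open RAM RAM.LProg BipartiteGraph

/-- The memory holds the instance, and array `14` the multiples of `m`. -/
structure Holds (x : BMatchingInstance) (σ : State) : Prop where
  var0 : σ.var 0 = x.n
  var1 : σ.var 1 = x.m
  arr0 : ∀ v : Fin x.n, σ.arr 0 (v : ℕ) = x.b v
  arr1 : ∀ v : Fin x.n, σ.arr 1 (v : ℕ) = if x.G.color v = true then 1 else 0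
  arr2 : ∀ e : Fin x.m, σ.arr 2 (e : ℕ) = (x.G.endA e : ℕ)
  arr3 : ∀ e : Fin x.m, σ.arr 3 (e : ℕ) = (x.G.endB e : ℕ)
  arr14 : ∀ v : Fin x.n, σ.arr 14 (v : ℕ) = (v : ℕ) * x.m

theorem Holds.agree {x : BMatchingInstance} {σ τ : State} {vs as : List ℕ} (h : x.Holds σ)
    (hag : Agree vs as σ τ)
    (hd : (0 ∉ vs ∧ 1 ∉ vs) ∧ 0 ∉ as ∧ 1 ∉ as ∧ 2 ∉ as ∧ 3 ∉ as ∧ 14 ∉ as) : x.Holds τ := by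
  obtain ⟨⟨h0, h1⟩, a0, a1, a2, a3, a14⟩ := hd
  constructor
  · rw [hag.1 0 h0, h.var0]
  · rw [hag.1 1 h1, h.var1]
  · rw [hag.2 0 a0]; exact h.arr0
  · rw [hag.2 1 a1]; exact h.arr1
  · rw [hag.2 2 a2]; exact h.arr2
  · rw [hag.2 3 a3]; exact h.arr3
  · rw [hag.2 14 a14]; exact h.arr14

/-- Copy `m` consecutive cells of the array `a`, from cell `j` on, to the array `c`, from cell `i`
on. -/
def copyRow (c : ℕ) (i : Expr) (a : ℕ) (j : Expr) : LProg :=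
  loop 16 1 (store c (.add i (.var 16)) (.load a (.add j (.var 16))))

/-- Within one array the source and target ranges have to be disjoint, so that no cell is
overwritten before it is read. -/
theorem run_copyRow {c a m : ℕ} {i j : Expr} {σ : State} {I J : ℤ} (hm : σ.var 1 = m)
    (hi : ∀ s, Agree [16] [c] σ s → i.eval s = I) (hj : ∀ s, Agree [16] [c] σ s → j.eval s = J)
    (hne : c = a → ∀ f f' : Fin m, I + (f : ℕ) ≠ J + (f' : ℕ)) :
    (∀ f : Fin m, ((copyRow c i a j).run σ).arr c (I + (f : ℕ)) = σ.arr a (J + (f : ℕ))) ∧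
      ∀ k, (∀ f : Fin m, k ≠ I + (f : ℕ)) → ((copyRow c i a j).run σ).arr c k = σ.arr c k := by
  have key := loop_induction (x := 16) (P := store c (.add i (.var 16)) (.load a (.add j (.var 16))))
    hm (fun l s => (∀ f : Fin m, (f : ℕ) < l → s.arr c (I + (f : ℕ)) = σ.arr a (J + (f : ℕ))) ∧
      ∀ k, (∀ f : Fin m, k ≠ I + (f : ℕ)) → s.arr c k = σ.arr c k) (fun _ _ _ h => h)
    ⟨fun _ h => absurd h (by omega), fun _ _ => rfl⟩ (by
      intro l s hs hag hI
      have hag' : Agree [16] [c] σ s := hag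
      have hrun : (store c (.add i (.var 16)) (.load a (.add j (.var 16)))).run s =
          s.setArr c (I + (l : ℕ)) (s.arr a (J + (l : ℕ))) := by
        simp only [run, Expr.eval, hi s hag', hj s hag', hs]
      have hval : s.arr a (J + (l : ℕ)) = σ.arr a (J + (l : ℕ)) := by
        by_cases hca : c = a
        · subst hca
          exact hI.2 _ fun f => (hne rfl f l).symm
        · rw [hag'.2 a (by simpa using Ne.symm hca)]
      rw [hrun, hval]
      refine ⟨fun f hf => ?_, fun k hk => ?_⟩
      · simp only [State.setArr_arr, true_and]
        split_ifs with h
        · have : f = l := Fin.ext (by omega)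
          rw [this]
        · exact hI.1 f (by
            have : (f : ℕ) ≠ l := fun h' => h (by rw [h'])
            omega)
      · simp only [State.setArr_arr, true_and, hk l, if_false]
        exact hI.2 k hk)
  exact ⟨fun f => key.1 f f.2, key.2⟩

/-! ### The search for an augmentation as a program. -/

/-- The current set of edges, in array `10`. -/
def edgeSet (m : ℕ) (σ : State) : Finset (Fin m) :=
  Finset.univ.filter fun e => σ.arr 10 (e : ℕ) = 1

/-- The vertices reached in the search, in array `11`. -/
def reached (n : ℕ) (σ : State) : Finset (Fin n) :=
  Finset.univ.filter fun v => σ.arr 11 (v : ℕ) = 1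

/-- The edge set that belongs to the vertex `v`, in array `12`. -/
def row (n m : ℕ) (σ : State) (v : Fin n) : Finset (Fin m) :=
  Finset.univ.filter fun e => σ.arr 12 ((v : ℕ) * m + (e : ℕ)) = 1

/-- The edges other than the one that is excluded by variable `2`. -/
def admitted (m : ℕ) (z : ℤ) : Finset (Fin m) := Finset.univ.filter fun e => ((e : ℕ) : ℤ) ≠ z

/-- Reach the vertex in variable `14` from the one in variable `13` along the edge in variable `12`,
which is added or removed according to variable `15`. -/
def extend : LProg :=
  copyRow 12 (.load 14 (.var 14)) 12 (.load 14 (.var 13)) ;;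
    store 12 (.add (.load 14 (.var 14)) (.var 12)) (.var 15) ;;
    store 11 (.var 14) (.const 1)

theorem run_extend {x : BMatchingInstance} {σ : State} (h : x.Holds σ) {p q : Fin x.n}
    {e : Fin x.m} (hp : σ.var 13 = (p : ℕ)) (hq : σ.var 14 = (q : ℕ)) (hpq : p ≠ q)
    (he : σ.var 12 = (e : ℕ)) :
    reached x.n (extend.run σ) = insert q (reached x.n σ) ∧
      (∀ w ≠ q, row x.n x.m (extend.run σ) w = row x.n x.m σ w) ∧
      ∀ f, f ∈ row x.n x.m (extend.run σ) q ↔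
        if f = e then σ.var 15 = 1 else f ∈ row x.n x.m σ p := by
  have hpq' : (q : ℕ) ≠ p := fun h => hpq (Fin.ext h.symm)
  obtain ⟨h1, h2⟩ := run_copyRow (c := 12) (a := 12) (i := .load 14 (.var 14))
    (j := .load 14 (.var 13)) h.var1 (I := (q : ℕ) * x.m) (J := (p : ℕ) * x.m)
    (by intro s hs; simp only [Expr.eval]; rw [hs.1 14 (by simp), hs.2 14 (by simp), hq, h.arr14])
    (by intro s hs; simp only [Expr.eval]; rw [hs.1 13 (by simp), hs.2 14 (by simp), hp, h.arr14])
    (by intro _ f f'; rw [Ne, row_major_inj]; exact fun h => hpq' h.1)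
  set τ := (copyRow 12 (.load 14 (.var 14)) 12 (.load 14 (.var 13))).run σ with hτ
  have hag : Agree [16] [12] σ τ :=
    run_agree (copyRow 12 (.load 14 (.var 14)) 12 (.load 14 (.var 13))) σ
  have hrun : extend.run σ = (τ.setArr 12 ((q : ℕ) * x.m + (e : ℕ)) (σ.var 15)).setArr 11 (q : ℕ) 1
      := by
    simp only [extend, run, ← hτ, Expr.eval, State.setArr_var]
    rw [hag.1 14 (by simp), hag.1 12 (by simp), hag.1 15 (by simp), hag.2 14 (by simp), hq, he,
      h.arr14]
  rw [hrun]
  refine ⟨?_, ?_, ?_⟩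
  · ext v
    simp only [reached, State.setArr_arr, true_and, Finset.mem_filter, Finset.mem_univ,
      Finset.mem_insert, Nat.cast_inj, ← Fin.ext_iff]
    rw [hag.2 11 (by simp)]
    by_cases hv : v = q <;> simp [hv]
  · intro w hw
    have hw' : (w : ℕ) ≠ q := fun h => hw (Fin.ext h)
    ext f
    simp only [row, State.setArr_arr, Finset.mem_filter, Finset.mem_univ, true_and, row_major_inj,
      hw', false_and, and_false, if_false]
    rw [if_neg (by simp), h2]
    intro f'
    rw [Ne, row_major_inj]
    exact fun h => hw' h.1
  · intro f
    simp only [row, State.setArr_arr, Finset.mem_filter, Finset.mem_univ, true_and, row_major_inj]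
    by_cases hf : f = e
    · simp [hf]
    · simp [hf, h1]

/-- Continue the search along the edge in variable `12`. -/
def relax : LProg :=
  ite (.not (.eq (.var 12) (.var 2)))
    (ite (.eq (.load 10 (.var 12)) (.const 1))
      (assign 13 (.load 3 (.var 12)) ;; assign 14 (.load 2 (.var 12)) ;; assign 15 (.const 0))
      (assign 13 (.load 2 (.var 12)) ;; assign 14 (.load 3 (.var 12)) ;; assign 15 (.const 1)) ;;
    ite (.and (.eq (.load 11 (.var 13)) (.const 1)) (.not (.eq (.load 11 (.var 14)) (.const 1))))
      extend skip)
    skip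

/-- Besides the invariant, this records that the reached set stays the same exactly if it is closed
at `e`; this detects the end of the search. -/
theorem run_relax {x : BMatchingInstance} {σ : State} (h : x.Holds σ) {b : Fin x.n → ℕ}
    {S M : Finset (Fin x.m)} {e : Fin x.m} (he : σ.var 12 = (e : ℕ))
    (hS : admitted x.m (σ.var 2) = S) (hM : edgeSet x.m σ = M) (hMS : M ⊆ S)
    (hinv : x.G.SearchInv S b M (· ∈ reached x.n σ) (row x.n x.m σ)) :
    x.G.SearchInv S b M (· ∈ reached x.n (relax.run σ)) (row x.n x.m (relax.run σ)) ∧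
      ((reached x.n (relax.run σ) = reached x.n σ ∧
          x.G.ClosedAt S M (· ∈ reached x.n σ) e) ∨
        ((∃ q ∉ reached x.n σ, reached x.n (relax.run σ) = insert q (reached x.n σ)) ∧
          ¬ x.G.ClosedAt S M (· ∈ reached x.n σ) e)) := by
  have hmem : ∀ v : Fin x.n, v ∈ reached x.n σ ↔ σ.arr 11 (v : ℕ) = 1 := fun v => by
    simp [reached]
  by_cases heS : σ.var 12 = σ.var 2
  -- The excluded edge belongs neither to `S` nor to `M`, so there is nothing to do for it.
  · have heS' : e ∉ S := by rw [← hS]; simp [admitted, ← he, heS]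
    have hrun : relax.run σ = σ := by simp [relax, run, Test.Holds, Expr.eval, heS]
    rw [hrun]
    exact ⟨hinv, Or.inl ⟨rfl, fun h => absurd h heS', fun h => absurd (hMS h) heS'⟩⟩
  · have hes : ((e : ℕ) : ℤ) ≠ σ.var 2 := he ▸ heS
    have heS' : e ∈ S := by rw [← hS]; simpa [admitted, ← he] using heS
    by_cases heM : e ∈ M
    -- Edges of `M` are traversed from `B` to `A` and removed; all others from `A` to `B` and added.
    · have heM' : σ.arr 10 (e : ℕ) = 1 := by rw [← hM] at heM; simpa [edgeSet] using heM
      set σ' := ((σ.setVar 13 (x.G.endB e : ℕ)).setVar 14 (x.G.endA e : ℕ)).setVar 15 0 with hσ'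
      have hag : Agree [13, 14, 15] [] σ σ' := by
        refine ⟨fun z hz => ?_, fun _ _ => rfl⟩
        simp only [List.mem_cons, List.not_mem_nil, or_false, not_or] at hz
        simp [hσ', hz]
      have hrun : relax.run σ = (ite (.and (.eq (.load 11 (.var 13)) (.const 1))
          (.not (.eq (.load 11 (.var 14)) (.const 1)))) extend skip).run σ' := by
        simp [relax, run, Test.Holds, Expr.eval, hes, he, heM', h.arr2, h.arr3, hσ']
      by_cases hc : x.G.endB e ∈ reached x.n σ ∧ x.G.endA e ∉ reached x.n σ
      · have hrun' : relax.run σ = extend.run σ' := by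
          rw [hrun]
          simp only [hmem] at hc
          simp [run, Test.Holds, Expr.eval, hσ', hc]
        obtain ⟨h1, h2, h3⟩ := run_extend (σ := σ') (h.agree hag (by simp)) (p := x.G.endB e)
          (q := x.G.endA e) (e := e) (by simp [hσ']) (by simp [hσ'])
          (fun h => hc.2 (h ▸ hc.1)) (by simp [hσ', he])
        rw [hrun']
        refine ⟨hinv.backward heM hc.1 hc.2 (fun w => ?_) h2 ?_, Or.inr ⟨⟨_, hc.2, h1⟩, fun hcl =>
          hc.2 (hcl.2 heM hc.1)⟩⟩
        · rw [h1, Finset.mem_insert, or_comm]; rfl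
        · ext f
          rw [h3, Finset.mem_erase]
          by_cases hf : f = e
          · simp [hf, hσ']
          · simp only [hf, if_false, ne_eq, not_false_iff, true_and]; rfl
      · have hrun' : relax.run σ = σ' := by
          rw [hrun]
          simp only [hmem] at hc
          simp only [run, Test.Holds, Expr.eval, hσ']
          rw [if_neg (by simpa using hc)]
        rw [hrun']
        refine ⟨hinv, Or.inl ⟨rfl, fun _ h => absurd heM h, fun _ hB => ?_⟩⟩
        by_contra hA
        exact hc ⟨hB, hA⟩
    · have heM' : σ.arr 10 (e : ℕ) ≠ 1 := by rw [← hM] at heM; simpa [edgeSet] using heM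
      set σ' := ((σ.setVar 13 (x.G.endA e : ℕ)).setVar 14 (x.G.endB e : ℕ)).setVar 15 1 with hσ'
      have hag : Agree [13, 14, 15] [] σ σ' := by
        refine ⟨fun z hz => ?_, fun _ _ => rfl⟩
        simp only [List.mem_cons, List.not_mem_nil, or_false, not_or] at hz
        simp [hσ', hz]
      have hrun : relax.run σ = (ite (.and (.eq (.load 11 (.var 13)) (.const 1))
          (.not (.eq (.load 11 (.var 14)) (.const 1)))) extend skip).run σ' := by
        simp [relax, run, Test.Holds, Expr.eval, hes, he, heM', h.arr2, h.arr3, hσ']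
      by_cases hc : x.G.endA e ∈ reached x.n σ ∧ x.G.endB e ∉ reached x.n σ
      · have hrun' : relax.run σ = extend.run σ' := by
          rw [hrun]
          simp only [hmem] at hc
          simp [run, Test.Holds, Expr.eval, hσ', hc]
        obtain ⟨h1, h2, h3⟩ := run_extend (σ := σ') (h.agree hag (by simp)) (p := x.G.endA e)
          (q := x.G.endB e) (e := e) (by simp [hσ']) (by simp [hσ'])
          (fun h => hc.2 (h ▸ hc.1)) (by simp [hσ', he])
        rw [hrun']
        refine ⟨hinv.forward heS' heM hc.1 hc.2 (fun w => ?_) h2 ?_, Or.inr ⟨⟨_, hc.2, h1⟩,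
          fun hcl => hc.2 (hcl.1 heS' heM hc.1)⟩⟩
        · rw [h1, Finset.mem_insert, or_comm]; rfl
        · ext f
          rw [h3, Finset.mem_insert]
          by_cases hf : f = e
          · simp [hf, hσ']
          · simp only [hf, if_false, false_or]; rfl
      · have hrun' : relax.run σ = σ' := by
          rw [hrun]
          simp only [hmem] at hc
          simp only [run, Test.Holds, Expr.eval, hσ']
          rw [if_neg (by simpa using hc)]
        rw [hrun']
        refine ⟨hinv, Or.inl ⟨rfl, fun _ _ hA => ?_, fun h => absurd h heM⟩⟩
        by_contra hB
        exact hc ⟨hA, hB⟩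

/-- One round of the search. -/
def searchRound : LProg := loop 12 1 relax

/-- If a round reaches no new vertex, all edges were tested against one and the same set, which is
therefore closed. Conversely a closed set is not extended by any edge. -/
theorem run_searchRound {x : BMatchingInstance} {σ : State} (h : x.Holds σ) {b : Fin x.n → ℕ}
    {S M : Finset (Fin x.m)}
    (hS : admitted x.m (σ.var 2) = S) (hM : edgeSet x.m σ = M) (hMS : M ⊆ S)
    (hinv : x.G.SearchInv S b M (· ∈ reached x.n σ) (row x.n x.m σ)) :
    x.G.SearchInv S b M (· ∈ reached x.n (searchRound.run σ)) (row x.n x.m (searchRound.run σ)) ∧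
      reached x.n σ ⊆ reached x.n (searchRound.run σ) ∧
      (reached x.n (searchRound.run σ) = reached x.n σ ↔
        ∀ e, x.G.ClosedAt S M (· ∈ reached x.n σ) e) := by
  have key := loop_induction (x := 12) (P := relax) h.var1
    (fun j s => x.G.SearchInv S b M (· ∈ reached x.n s) (row x.n x.m s) ∧
      reached x.n σ ⊆ reached x.n s ∧
      (reached x.n s = reached x.n σ → ∀ e : Fin x.m, (e : ℕ) < j →
        x.G.ClosedAt S M (· ∈ reached x.n σ) e) ∧
      ((∀ e, x.G.ClosedAt S M (· ∈ reached x.n σ) e) → reached x.n s = reached x.n σ))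
    (fun _ _ _ h => h)
    ⟨hinv, subset_rfl, fun _ e he => absurd he (by omega), fun _ => rfl⟩ (by
      rintro e s hs hag ⟨h1, h2, h3, h3'⟩
      have hM' : edgeSet x.m s = M := by
        rw [← hM]; simp only [edgeSet, hag.2 10 (by decide)]
      obtain ⟨h4, h5⟩ := run_relax (h.agree hag (by decide)) hs
        (by rw [hag.1 2 (by decide), hS]) hM' hMS h1
      refine ⟨h4, ?_⟩
      rcases h5 with ⟨h5, h6⟩ | ⟨⟨q, hq, h5⟩, h6⟩
      · rw [h5]
        refine ⟨h2, fun heq f hf => ?_, h3'⟩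
        by_cases hfe : f = e
        · rw [heq] at h6; exact hfe ▸ h6
        · exact h3 heq f (by have := fun h => hfe (Fin.ext h); omega)
      · rw [h5]
        refine ⟨h2.trans (Finset.subset_insert _ _), fun heq => ?_, fun hcl => ?_⟩
        · exact absurd (h2 (heq ▸ Finset.mem_insert_self q _)) hq
        · rw [h3' hcl] at h6; exact absurd (hcl e) h6)
  obtain ⟨h1, h2, h3, h4⟩ := key
  exact ⟨h1, h2, fun heq e => h3 heq e e.2, h4⟩

/-- The search for an augmentation. -/
def search : LProg := loop 11 0 searchRound

/-- Every round reaches a new vertex unless the set is closed already, so `n` rounds suffice. -/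
theorem run_search {x : BMatchingInstance} {σ : State} (h : x.Holds σ) {b : Fin x.n → ℕ}
    {S M : Finset (Fin x.m)}
    (hS : admitted x.m (σ.var 2) = S) (hM : edgeSet x.m σ = M) (hMS : M ⊆ S)
    (hinv : x.G.SearchInv S b M (· ∈ reached x.n σ) (row x.n x.m σ)) :
    x.G.SearchInv S b M (· ∈ reached x.n (search.run σ)) (row x.n x.m (search.run σ)) ∧
      reached x.n σ ⊆ reached x.n (search.run σ) ∧
      ∀ e, x.G.ClosedAt S M (· ∈ reached x.n (search.run σ)) e := by
  have key := loop_induction (x := 11) (P := searchRound) h.var0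
    (fun j s => x.G.SearchInv S b M (· ∈ reached x.n s) (row x.n x.m s) ∧
      reached x.n σ ⊆ reached x.n s ∧
      ((∀ e, x.G.ClosedAt S M (· ∈ reached x.n s) e) ∨ j ≤ (reached x.n s).card))
    (fun _ _ _ h => h) ⟨hinv, subset_rfl, Or.inr (Nat.zero_le _)⟩ (by
      rintro j s hs hag ⟨h1, h2, h3⟩
      have hM' : edgeSet x.m s = M := by
        rw [← hM]; simp only [edgeSet, hag.2 10 (by decide)]
      obtain ⟨h4, h5, h6⟩ := run_searchRound (h.agree hag (by decide))
        (by rw [hag.1 2 (by decide), hS]) hM' hMS h1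
      refine ⟨h4, h2.trans h5, ?_⟩
      by_cases heq : reached x.n (searchRound.run s) = reached x.n s
      · rw [heq]; exact Or.inl (h6.1 heq)
      · have hlt := Finset.card_lt_card (h5.ssubset_of_ne (Ne.symm heq))
        rcases h3 with h3 | h3
        · exact absurd (h6.2 h3) heq
        · exact Or.inr (by omega))
  obtain ⟨h1, h2, h3⟩ := key
  refine ⟨h1, h2, ?_⟩
  rcases h3 with h3 | h3
  · exact h3
  -- After `n` strict enlargements all vertices are reached, and the set of all vertices is closed.
  · have huniv : reached x.n (search.run σ) = Finset.univ := by
      rw [← Finset.card_eq_iff_eq_univ, Fintype.card_fin]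
      exact le_antisymm (by simpa using Finset.card_le_univ (reached x.n (search.run σ))) h3
    intro e
    rw [huniv]
    exact ⟨fun _ _ _ => Finset.mem_univ _, fun _ _ => Finset.mem_univ _⟩

/-! ### Augmentation steps and the size of a maximum `b`-matching. -/

/-- Compute the degrees of the vertices in the current set of edges, in array `13`. -/
def degrees : LProg :=
  loop 18 0 (count 17 19 1 (.and (.eq (.load 10 (.var 19)) (.const 1))
      (.not (.and (.not (.eq (.load 2 (.var 19)) (.var 18)))
        (.not (.eq (.load 3 (.var 19)) (.var 18)))))) ;;
    store 13 (.var 18) (.var 17))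

theorem run_degrees {x : BMatchingInstance} {σ : State} (h : x.Holds σ) (v : Fin x.n) :
    (degrees.run σ).arr 13 (v : ℕ) = x.G.degree (edgeSet x.m σ) v := by
  refine loop_fill h.var0 (fun v z => z = x.G.degree (edgeSet x.m σ) v) ?_ v
  intro v s hs hag
  have hs' := h.agree hag (by decide)
  have hcount := run_count (c := 17) (x := 19) hs'.var1 (by decide) (by decide)
    (t := .and (.eq (.load 10 (.var 19)) (.const 1))
      (.not (.and (.not (.eq (.load 2 (.var 19)) (.var 18)))
        (.not (.eq (.load 3 (.var 19)) (.var 18))))))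
    (fun e => e ∈ edgeSet x.m σ ∧ (x.G.endA e = v ∨ x.G.endB e = v)) (by
      intro e r hr hag'
      simp only [Test.Holds, Expr.eval, hr]
      rw [hag'.2 10 (by decide), hag'.2 2 (by decide), hag'.2 3 (by decide), hag'.1 18 (by decide),
        hag.2 10 (by decide), hs, hs'.arr2, hs'.arr3]
      simp only [edgeSet, Finset.mem_filter, Finset.mem_univ, true_and, Nat.cast_inj, Fin.ext_iff]
      tauto)
  have hv : ((count 17 19 1 (.and (.eq (.load 10 (.var 19)) (.const 1))
      (.not (.and (.not (.eq (.load 2 (.var 19)) (.var 18)))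
        (.not (.eq (.load 3 (.var 19)) (.var 18))))))).run s).var 18 = (v : ℕ) := by
    rw [run_var (by decide), hs]
  simp only [run, Expr.eval, hv, hcount, State.setArr_arr, true_and, if_true]
  refine ⟨?_, fun j hj => ?_⟩
  · rw [degree_eq]
    congr 2
    ext e
    simp
  · rw [if_neg hj, run_arr (by decide)]

/-- Start the search: reach the loose vertices in the color class `A`. -/
def start : LProg :=
  loop 18 0 (storeTest 11 (.var 18) (.and (.eq (.load 1 (.var 18)) (.const 1))
    (.lt (.load 13 (.var 18)) (.load 9 (.var 18))))) ;;
  loop 18 0 (copyRow 12 (.load 14 (.var 18)) 10 (.const 0))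

theorem run_start {x : BMatchingInstance} {σ : State} (h : x.Holds σ) {b d : Fin x.n → ℕ}
    (hb : ∀ v : Fin x.n, σ.arr 9 (v : ℕ) = b v) (hd : ∀ v : Fin x.n, σ.arr 13 (v : ℕ) = d v) :
    (∀ v, v ∈ reached x.n (start.run σ) ↔ x.G.color v = true ∧ d v < b v) ∧
      ∀ v, row x.n x.m (start.run σ) v = edgeSet x.m σ := by
  set P := loop 18 0 (storeTest 11 (.var 18) (.and (.eq (.load 1 (.var 18)) (.const 1))
    (.lt (.load 13 (.var 18)) (.load 9 (.var 18))))) with hP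
  set Q := loop 18 0 (copyRow 12 (.load 14 (.var 18)) 10 (.const 0)) with hQ
  have hrun : start.run σ = Q.run (P.run σ) := rfl
  have h' : x.Holds (P.run σ) := h.agree (P.run_agree σ) (by decide)
  constructor
  · intro v
    have hfill := loop_fill (x := 18) (a := 11) (P := storeTest 11 (.var 18)
        (.and (.eq (.load 1 (.var 18)) (.const 1)) (.lt (.load 13 (.var 18)) (.load 9 (.var 18)))))
        h.var0
      (fun v z => z = 1 ↔ x.G.color v = true ∧ d v < b v) (by
        intro v s hs hag
        have hs' := h.agree hag (by decide)
        rw [run_storeTest]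
        simp only [Test.Holds, Expr.eval, hs, State.setArr_arr, true_and, if_true]
        rw [hag.2 13 (by decide), hag.2 9 (by decide), hb, hd, hs'.arr1]
        refine ⟨?_, fun j hj => if_neg hj⟩
        by_cases hc : x.G.color v = true <;> by_cases hl : d v < b v <;> simp [hc, hl]) v
    rw [← hfill, hrun]
    simp only [reached, Finset.mem_filter, Finset.mem_univ, true_and]
    rw [run_arr (P := Q) (by decide)]
  · have key := loop_induction (x := 18) (P := copyRow 12 (.load 14 (.var 18)) 10 (.const 0))
      h'.var0 (fun j s => ∀ v : Fin x.n, (v : ℕ) < j → row x.n x.m s v = edgeSet x.m σ)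
      (fun _ _ _ h => h) (fun _ hv => absurd hv (by omega)) (by
        intro v s hs hag hI w hw
        have hs' := h'.agree hag (by decide)
        have h10 : s.arr 10 = σ.arr 10 := by rw [hag.2 10 (by decide), run_arr (by decide)]
        obtain ⟨h1, h2⟩ := run_copyRow (c := 12) (a := 10) (i := .load 14 (.var 18)) (j := .const 0)
          (σ := s) hs'.var1 (I := (v : ℕ) * x.m) (J := 0)
          (by intro r hr; simp only [Expr.eval]
              rw [hr.1 18 (by decide), hr.2 14 (by decide), hs, hs'.arr14])
          (fun _ _ => rfl) (by simp)
        by_cases hwv : w = v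
        · subst hwv
          ext e
          simp [row, edgeSet, h1, h10]
        · rw [← hI w (by have := fun h => hwv (Fin.ext h); omega)]
          ext e
          simp only [row, Finset.mem_filter, Finset.mem_univ, true_and]
          rw [h2]
          intro f
          rw [Ne, row_major_inj]
          exact fun h => hwv (Fin.ext h.1))
    rw [hrun]
    exact fun v => key v v.2

/-- Replace the current set of edges by the one that belongs to a loose vertex of the color class
`B`, if such a vertex has been reached. -/
def finish : LProg :=
  loop 18 0 (ite (.and (.not (.eq (.load 1 (.var 18)) (.const 1)))
      (.and (.eq (.load 11 (.var 18)) (.const 1)) (.lt (.load 13 (.var 18)) (.load 9 (.var 18)))))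
    (copyRow 10 (.const 0) 12 (.load 14 (.var 18))) skip)

theorem run_finish {x : BMatchingInstance} {σ : State} (h : x.Holds σ) {b d : Fin x.n → ℕ}
    (hb : ∀ v : Fin x.n, σ.arr 9 (v : ℕ) = b v) (hd : ∀ v : Fin x.n, σ.arr 13 (v : ℕ) = d v) :
    (edgeSet x.m (finish.run σ) = edgeSet x.m σ ∧
        ∀ v ∈ reached x.n σ, x.G.color v = false → b v ≤ d v) ∨
      ∃ v ∈ reached x.n σ, x.G.color v = false ∧ d v < b v ∧
        edgeSet x.m (finish.run σ) = row x.n x.m σ v := by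
  have key := loop_induction (x := 18) (P := ite (.and (.not (.eq (.load 1 (.var 18)) (.const 1)))
      (.and (.eq (.load 11 (.var 18)) (.const 1)) (.lt (.load 13 (.var 18)) (.load 9 (.var 18)))))
      (copyRow 10 (.const 0) 12 (.load 14 (.var 18))) skip) h.var0
    (fun j s => (edgeSet x.m s = edgeSet x.m σ ∧
        ∀ v ∈ reached x.n σ, (v : ℕ) < j → x.G.color v = false → b v ≤ d v) ∨
      ∃ v ∈ reached x.n σ, x.G.color v = false ∧ d v < b v ∧ edgeSet x.m s = row x.n x.m σ v)
    (fun _ _ _ h => h) (Or.inl ⟨rfl, fun _ _ hv => absurd hv (by omega)⟩) (by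
      intro v s hs hag hI
      have hs' := h.agree hag (by decide)
      have hiff : Test.Holds s (.and (.not (.eq (.load 1 (.var 18)) (.const 1)))
          (.and (.eq (.load 11 (.var 18)) (.const 1))
            (.lt (.load 13 (.var 18)) (.load 9 (.var 18))))) ↔
          x.G.color v = false ∧ v ∈ reached x.n σ ∧ d v < b v := by
        simp only [Test.Holds, Expr.eval, hs]
        rw [hag.2 13 (by decide), hag.2 9 (by decide), hag.2 11 (by decide), hb, hd, hs'.arr1]
        simp [reached]
      by_cases hc : x.G.color v = false ∧ v ∈ reached x.n σ ∧ d v < b v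
      -- A later loose vertex overwrites the choice of an earlier one. This is harmless, since the
      -- rows in array `12` are only read and each of these choices is an augmentation.
      · right
        obtain ⟨h1, -⟩ := run_copyRow (c := 10) (a := 12) (j := .load 14 (.var 18)) (i := .const 0)
          (σ := s) hs'.var1 (J := (v : ℕ) * x.m) (I := 0) (fun _ _ => rfl)
          (by intro r hr; simp only [Expr.eval]
              rw [hr.1 18 (by decide), hr.2 14 (by decide), hs, hs'.arr14]) (by simp)
        refine ⟨v, hc.2.1, hc.1, hc.2.2, ?_⟩
        simp only [run, hiff.2 hc, if_true]
        ext e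
        have := h1 e
        rw [zero_add, hag.2 12 (by decide)] at this
        simp [edgeSet, row, this]
      · simp only [run, mt hiff.1 hc, if_false]
        refine hI.imp_left fun hI => ⟨hI.1, fun w hw hwj hcw => ?_⟩
        by_cases hwv : w = v
        · subst hwv
          by_contra hlt
          exact hc ⟨hcw, hw, by omega⟩
        · exact hI.2 w hw (by have := fun h => hwv (Fin.ext h); omega) hcw)
  exact key.imp_left fun h => ⟨h.1, fun v hv => h.2 v hv v.2⟩

/-- Enlarge the current set of edges if it is not maximum. -/
def augment : LProg := degrees ;; start ;; search ;; finish

theorem run_augment {x : BMatchingInstance} {σ : State} (h : x.Holds σ) {b : Fin x.n → ℕ}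
    {S M : Finset (Fin x.m)} (hb : ∀ v : Fin x.n, σ.arr 9 (v : ℕ) = b v)
    (hS : admitted x.m (σ.var 2) = S) (hM : edgeSet x.m σ = M) (hMS : M ⊆ S)
    (hMb : x.G.IsBMatching b M) :
    (edgeSet x.m (augment.run σ) = M ∧ x.G.IsMaxIn S b M) ∨
      (edgeSet x.m (augment.run σ) ⊆ S ∧ x.G.IsBMatching b (edgeSet x.m (augment.run σ)) ∧
        (edgeSet x.m (augment.run σ)).card = M.card + 1) := by
  set σ₁ := degrees.run σ with h₁
  set σ₂ := start.run σ₁ with h₂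
  set σ₃ := search.run σ₂ with h₃
  have hrun : augment.run σ = finish.run σ₃ := rfl
  have ag₁ : Agree degrees.vars degrees.arrs σ σ₁ := degrees.run_agree σ
  have ag₂ : Agree start.vars start.arrs σ₁ σ₂ := start.run_agree σ₁
  have ag₃ : Agree search.vars search.arrs σ₂ σ₃ := search.run_agree σ₂
  have hh₁ := h.agree ag₁ (by decide)
  have hh₂ := hh₁.agree ag₂ (by decide)
  have hh₃ := hh₂.agree ag₃ (by decide)
  have hd₁ : ∀ v : Fin x.n, σ₁.arr 13 (v : ℕ) = x.G.degree M v := fun v => by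
    rw [h₁, run_degrees h, hM]
  have hb₁ : ∀ v : Fin x.n, σ₁.arr 9 (v : ℕ) = b v := by rw [ag₁.2 9 (by decide)]; exact hb
  have hM₁ : edgeSet x.m σ₁ = M := by rw [← hM]; simp only [edgeSet, ag₁.2 10 (by decide)]
  obtain ⟨hR₂, hN₂⟩ := run_start hh₁ hb₁ hd₁
  rw [hM₁] at hN₂
  have hM₂ : edgeSet x.m σ₂ = M := by rw [← hM₁]; simp only [edgeSet, ag₂.2 10 (by decide)]
  have hS₂ : admitted x.m (σ₂.var 2) = S := by
    rw [ag₂.1 2 (by decide), ag₁.1 2 (by decide), hS]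
  obtain ⟨hinv, hsub, hcl⟩ := run_search hh₂ hS₂ hM₂ hMS (SearchInv.init hMS hMb hR₂ hN₂)
  have hM₃ : edgeSet x.m σ₃ = M := by rw [← hM₂]; simp only [edgeSet, ag₃.2 10 (by decide)]
  have hd₃ : ∀ v : Fin x.n, σ₃.arr 13 (v : ℕ) = x.G.degree M v := by
    rw [ag₃.2 13 (by decide), ag₂.2 13 (by decide)]; exact hd₁
  have hb₃ : ∀ v : Fin x.n, σ₃.arr 9 (v : ℕ) = b v := by
    rw [ag₃.2 9 (by decide), ag₂.2 9 (by decide)]; exact hb₁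
  rw [hrun]
  rcases run_finish hh₃ hb₃ hd₃ with ⟨heq, htgt⟩ | ⟨v, hv, hc, hlt, heq⟩
  · exact Or.inl ⟨heq.trans hM₃, isMaxIn_of_closed hMS hMb
      (fun v hc hlt => hsub ((hR₂ v).2 ⟨hc, hlt⟩)) hcl htgt⟩
  · rw [heq]
    exact Or.inr ⟨hinv.sub v hv, hinv.isBMatching hMb hv hc hlt, hinv.cardB v hv hc⟩

/-- Compute the size of a maximum `b`-matching that avoids the edge in variable `2`, where `b` is
given in array `9`; the result is in variable `3`. -/
def maxSize : LProg :=
  loop 18 1 (store 10 (.var 18) (.const 0)) ;;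
  loop 10 1 augment ;;
  count 3 18 1 (.eq (.load 10 (.var 18)) (.const 1))

/-- The number of augmentations is limited by the number of edges, not by `b`, because a
`b`-matching uses each edge at most once. -/
theorem run_maxSize {x : BMatchingInstance} {σ : State} (h : x.Holds σ) {b : Fin x.n → ℕ}
    {S : Finset (Fin x.m)} (hb : ∀ v : Fin x.n, σ.arr 9 (v : ℕ) = b v)
    (hS : admitted x.m (σ.var 2) = S) :
    ∃ M, x.G.IsMaxIn S b M ∧ (maxSize.run σ).var 3 = M.card := by
  set σ₁ := (loop 18 1 (store 10 (.var 18) (.const 0))).run σ with h₁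
  set σ₂ := (loop 10 1 augment).run σ₁ with h₂
  have hrun : maxSize.run σ = (count 3 18 1 (.eq (.load 10 (.var 18)) (.const 1))).run σ₂ := rfl
  have ag₁ : Agree [18] [10] σ σ₁ := run_agree (loop 18 1 (store 10 (.var 18) (.const 0))) σ
  have ag₂ : Agree (10 :: augment.vars) augment.arrs σ₁ σ₂ := run_agree (loop 10 1 augment) σ₁
  have hh₁ := h.agree ag₁ (by decide)
  have hh₂ := hh₁.agree ag₂ (by decide)
  have hM₁ : edgeSet x.m σ₁ = ∅ := by
    have := loop_fill (x := 18) (a := 10) (P := store 10 (.var 18) (.const 0)) h.var1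
      (fun _ z => z = 0) (by
        intro e s hs _
        simp only [run, Expr.eval, hs, State.setArr_arr, true_and, if_true]
        exact fun j hj => if_neg hj)
    refine Finset.filter_eq_empty_iff.2 fun e _ => ?_
    rw [h₁, this e]
    simp
  have hb₁ : ∀ v : Fin x.n, σ₁.arr 9 (v : ℕ) = b v := by rw [ag₁.2 9 (by decide)]; exact hb
  -- After `j` rounds the current set is maximum or has at least `j` edges; with `m` edges nothing
  -- can be larger.
  have key := loop_induction (x := 10) (P := augment) hh₁.var1
    (fun j s => edgeSet x.m s ⊆ S ∧ x.G.IsBMatching b (edgeSet x.m s) ∧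
      (x.G.IsMaxIn S b (edgeSet x.m s) ∨ j ≤ (edgeSet x.m s).card)) (fun _ _ _ h => h)
    (by rw [hM₁]; exact ⟨Finset.empty_subset _, x.G.isBMatching_empty b, Or.inr le_rfl⟩) (by
      rintro j s hs hag ⟨hI1, hI2, hI3⟩
      rcases run_augment (hh₁.agree hag (by decide)) (b := b) (S := S)
        (by rw [hag.2 9 (by decide)]; exact hb₁)
        (by rw [hag.1 2 (by decide), ag₁.1 2 (by decide), hS]) rfl hI1 hI2 with
        ⟨h4, h5⟩ | ⟨h4, h5, h6⟩
      · rw [h4]; exact ⟨hI1, hI2, Or.inl h5⟩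
      · refine ⟨h4, h5, ?_⟩
        rcases hI3 with hI3 | hI3
        · have := hI3.2.2 _ h4 h5; omega
        · exact Or.inr (by omega))
  refine ⟨edgeSet x.m σ₂, ?_, ?_⟩
  · obtain ⟨h1, h2, h3⟩ := key
    refine h3.elim id fun h3 => ⟨h1, h2, fun N _ _ => ?_⟩
    exact (show N.card ≤ x.m by simpa using Finset.card_le_univ N).trans h3
  · rw [hrun, run_count (c := 3) (x := 18) hh₂.var1 (by decide) (by decide)
      (fun e : Fin x.m => σ₂.arr 10 (e : ℕ) = 1) (by
        intro e s hs hag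
        simp only [Test.Holds, Expr.eval, hs]
        rw [hag.2 10 (by decide)])]
    rfl

end BMatchingInstance

/-! ### The decomposition program -/

namespace BMatchingInstance

open RAM RAM.LProg BipartiteGraph

theorem isTruthValue_ite {p q : Prop} [Decidable p] (h : p ↔ q) :
    IsTruthValue (if p then 1 else 0) q := by
  by_cases hp : p
  · exact Or.inl ⟨h.1 hp, if_pos hp⟩
  · exact Or.inr ⟨mt h.2 hp, if_neg hp⟩

theorem IsTruthValue.eq_one_iff {z : ℤ} {p : Prop} (h : IsTruthValue z p) : z = 1 ↔ p := by
  rcases h with ⟨hp, rfl⟩ | ⟨hp, rfl⟩ <;> simp [hp]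

theorem IsTruthValue.eq_zero_iff {z : ℤ} {p : Prop} (h : IsTruthValue z p) : z = 0 ↔ ¬ p := by
  rcases h with ⟨hp, rfl⟩ | ⟨hp, rfl⟩ <;> simp [hp]

theorem IsTruthValue.congr {z : ℤ} {p q : Prop} (h : IsTruthValue z p) (hpq : p ↔ q) :
    IsTruthValue z q := by
  unfold IsTruthValue at *
  rwa [← hpq]

/-- Compute the multiples of `m` in array `14` and those of `n` in array `15`. -/
def multiples : LProg :=
  loop 4 0 (store 14 (.var 4) (.var 6) ;; store 15 (.var 4) (.var 7) ;;
    assign 6 (.add (.var 6) (.var 1)) ;; assign 7 (.add (.var 7) (.var 0)))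

theorem tabulate_coe {k : ℕ} (f : Fin k → ℤ) (i : Fin k) : tabulate f (i : ℕ) = f i := by
  simp [tabulate]

theorem run_multiples (x : BMatchingInstance) :
    x.Holds (multiples.run x.input) ∧
      ∀ v : Fin x.n, (multiples.run x.input).arr 15 (v : ℕ) = (v : ℕ) * x.n := by
  have h0 : x.input.var 0 = x.n := rfl
  have h1 : x.input.var 1 = x.m := rfl
  have key := loop_induction (x := 4) (P := store 14 (.var 4) (.var 6) ;;
    store 15 (.var 4) (.var 7) ;;
    assign 6 (.add (.var 6) (.var 1)) ;; assign 7 (.add (.var 7) (.var 0))) h0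
    (fun j s => (s.var 6 = (j : ℕ) * x.m ∧ s.var 7 = (j : ℕ) * x.n) ∧
      ∀ v : Fin x.n, (v : ℕ) < j →
        s.arr 14 (v : ℕ) = (v : ℕ) * x.m ∧ s.arr 15 (v : ℕ) = (v : ℕ) * x.n)
    (by intro i s z h; simpa using h)
    -- Variables `6` and `7` are `0` in the input and serve as accumulators.
    ⟨by simp [input], fun _ hv => absurd hv (by omega)⟩ (by
      rintro j s hs hag ⟨⟨h6, h7⟩, hI⟩
      have e0 : s.var 0 = x.n := by rw [hag.1 0 (by decide), h0]
      have e1 : s.var 1 = x.m := by rw [hag.1 1 (by decide), h1]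
      simp only [run, Expr.eval, State.setVar_var, State.setVar_arr, State.setArr_arr,
        State.setArr_var, hs, h6, h7, e0, e1]
      refine ⟨⟨by simp; ring, by simp; ring⟩, fun v hv => ?_⟩
      by_cases hvj : v = j
      · simp [hvj]
      · have hvj' : (v : ℕ) ≠ j := fun h => hvj (Fin.ext h)
        simpa [hvj'] using hI v (by omega))
  have hag := multiples.run_agree x.input
  refine ⟨⟨?_, ?_, ?_, ?_, ?_, ?_, fun v => (key.2 v v.2).1⟩, fun v => (key.2 v v.2).2⟩
  · rw [hag.1 0 (by decide), h0]
  · rw [hag.1 1 (by decide), h1]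
  · rw [hag.2 0 (by decide)]; exact tabulate_coe fun v => (x.b v : ℤ)
  · rw [hag.2 1 (by decide)]; exact tabulate_coe fun v => if x.G.color v = true then 1 else 0
  · rw [hag.2 2 (by decide)]; exact tabulate_coe fun e => ((x.G.endA e : ℕ) : ℤ)
  · rw [hag.2 3 (by decide)]; exact tabulate_coe fun e => ((x.G.endB e : ℕ) : ℤ)

/-- Copy the map `b` to array `9`. -/
def copyB : LProg := loop 18 0 (store 9 (.var 18) (.load 0 (.var 18)))

theorem run_copyB {x : BMatchingInstance} {σ : State} (h : x.Holds σ) (v : Fin x.n) :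
    (copyB.run σ).arr 9 (v : ℕ) = x.b v := by
  refine loop_fill h.var0 (fun v z => z = x.b v) ?_ v
  intro v s hs hag
  have hs' := h.agree hag (by decide)
  simp only [run, Expr.eval, hs, State.setArr_arr, true_and, if_true, hs'.arr0]
  exact fun j hj => if_neg hj

theorem admitted_neg_one (m : ℕ) : admitted m (-1) = Finset.univ := by
  ext e; simp [admitted]

theorem admitted_coe {m : ℕ} (e : Fin m) : admitted m (e : ℕ) = Finset.univ.erase e := by
  ext f; simp [admitted, Fin.ext_iff]

/-! ### Loose vertices, inevitable edges and allowed edges. -/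

/-- Compute the size of a maximum `b`-matching, in variable `5`. -/
def totalSize : LProg := copyB ;; assign 2 (.const (-1)) ;; maxSize ;; assign 5 (.var 3)

/-- The value `-1` is the index of no edge, so nothing is excluded; it stays in variable `2` for
`looseArray`. -/
theorem run_totalSize {x : BMatchingInstance} {σ : State} (h : x.Holds σ) :
    (totalSize.run σ).var 2 = -1 ∧
      ∃ M, x.G.IsMaxIn Finset.univ x.b M ∧ (totalSize.run σ).var 5 = M.card := by
  have hag : Agree (copyB ;; assign 2 (.const (-1))).vars _ σ _ :=
    (copyB ;; assign 2 (.const (-1))).run_agree σ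
  obtain ⟨M, hM, hc⟩ := run_maxSize (x := x)
    (σ := (copyB ;; assign 2 (.const (-1))).run σ) (b := x.b) (S := Finset.univ)
    (h.agree hag (by decide)) (run_copyB h) (by simp [run, Expr.eval, admitted_neg_one])
  have hrun : totalSize.run σ =
      (assign 5 (.var 3)).run (maxSize.run ((copyB ;; assign 2 (.const (-1))).run σ)) := rfl
  rw [hrun]
  refine ⟨?_, M, hM, by simpa [run, Expr.eval] using hc⟩
  rw [run_var (by decide), run_var (by decide)]
  simp [run, Expr.eval]

/-- Compute the indicator of the loose vertices, in array `16`. -/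
def looseArray : LProg :=
  loop 4 0 (ite (.lt (.const 0) (.load 0 (.var 4)))
    (copyB ;; store 9 (.var 4) (.sub (.load 9 (.var 4)) (.const 1)) ;; maxSize ;;
      storeTest 16 (.var 4) (.eq (.var 3) (.var 5)))
    (store 16 (.var 4) (.const 0)))

theorem run_looseArray {x : BMatchingInstance} {σ : State} (h : x.Holds σ) {M : Finset (Fin x.m)}
    (hM : x.G.IsMaxIn Finset.univ x.b M) (h2 : σ.var 2 = -1) (h5 : σ.var 5 = M.card)
    (v : Fin x.n) :
    IsTruthValue ((looseArray.run σ).arr 16 (v : ℕ)) (v ∈ x.G.looseVertices x.b) := by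
  refine loop_fill h.var0 (fun v z => IsTruthValue z (v ∈ x.G.looseVertices x.b)) ?_ v
  intro v s hs hag
  have hs' := h.agree hag (by decide)
  by_cases hv : 0 < x.b v
  · set τ := (copyB ;; store 9 (.var 4) (.sub (.load 9 (.var 4)) (.const 1))).run s with hτ
    have hagτ : Agree _ _ s τ :=
      (copyB ;; store 9 (.var 4) (.sub (.load 9 (.var 4)) (.const 1))).run_agree s
    have hb9 : ∀ w : Fin x.n, τ.arr 9 (w : ℕ) = ((if w = v then x.b w - 1 else x.b w : ℕ) : ℤ) := by
      intro w
      simp only [hτ, run, Expr.eval, State.setArr_arr, true_and]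
      rw [run_var (by decide), hs, run_copyB hs', run_copyB hs']
      by_cases hw : w = v
      -- Integer subtraction in the program agrees with truncated subtraction because of `hv`.
      · subst hw; simp; omega
      · have hw' : (w : ℕ) ≠ v := fun h => hw (Fin.ext h)
        simp [hw, hw']
    obtain ⟨N, hN, hc⟩ := run_maxSize (hs'.agree hagτ (by decide)) hb9
      (by rw [hagτ.1 2 (by decide), hag.1 2 (by decide), h2, admitted_neg_one])
    have hrun : ∀ Q, (ite (.lt (.const 0) (.load 0 (.var 4)))
        (copyB ;; store 9 (.var 4) (.sub (.load 9 (.var 4)) (.const 1)) ;; maxSize ;;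
          storeTest 16 (.var 4) (.eq (.var 3) (.var 5))) Q).run s =
        (storeTest 16 (.var 4) (.eq (.var 3) (.var 5))).run (maxSize.run τ) := by
      intro Q
      simp [run, Test.Holds, Expr.eval, hs, hs'.arr0, hv, hτ]
    have ag : Agree _ _ τ (maxSize.run τ) := maxSize.run_agree τ
    have e4 : (maxSize.run τ).var 4 = (v : ℕ) := by
      rw [ag.1 4 (by decide), hagτ.1 4 (by decide), hs]
    have e5 : (maxSize.run τ).var 5 = M.card := by
      rw [ag.1 5 (by decide), hagτ.1 5 (by decide), hag.1 5 (by decide), h5]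
    rw [hrun, run_storeTest]
    simp only [Test.Holds, Expr.eval, e4, e5, hc, State.setArr_arr, true_and, if_true, Nat.cast_inj]
    refine ⟨isTruthValue_ite (mem_looseVertices_iff hM hv (fun _ => rfl) hN).symm, fun j hj => ?_⟩
    rw [if_neg hj, ag.2 16 (by decide), hagτ.2 16 (by decide)]
  · have hrun : ∀ P, (ite (.lt (.const 0) (.load 0 (.var 4))) P
        (store 16 (.var 4) (.const 0))).run s = s.setArr 16 (v : ℕ) 0 := by
      intro P
      simp [run, Test.Holds, Expr.eval, hs, hs'.arr0, hv]
    rw [hrun]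
    simp only [State.setArr_arr, true_and, if_true]
    exact ⟨Or.inr ⟨fun h => hv (pos_of_mem_looseVertices h), rfl⟩, fun j hj => if_neg hj⟩

/-- Compute the indicator of the inevitable edges, in array `17`. -/
def inevitableArray : LProg :=
  loop 4 1 (copyB ;; assign 2 (.var 4) ;; maxSize ;;
    storeTest 17 (.var 4) (.not (.eq (.var 3) (.var 5))))

theorem run_inevitableArray {x : BMatchingInstance} {σ : State} (h : x.Holds σ)
    {M : Finset (Fin x.m)} (hM : x.G.IsMaxIn Finset.univ x.b M) (h5 : σ.var 5 = M.card)
    (e : Fin x.m) :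
    IsTruthValue ((inevitableArray.run σ).arr 17 (e : ℕ)) (x.G.Inevitable x.b e) := by
  refine loop_fill h.var1 (fun e z => IsTruthValue z (x.G.Inevitable x.b e)) ?_ e
  intro e s hs hag
  have hs' := h.agree hag (by decide)
  set τ := (copyB ;; assign 2 (.var 4)).run s with hτ
  have hagτ : Agree _ _ s τ := (copyB ;; assign 2 (.var 4)).run_agree s
  have hb9 : ∀ w : Fin x.n, τ.arr 9 (w : ℕ) = x.b w := run_copyB hs'
  obtain ⟨N, hN, hc⟩ := run_maxSize (hs'.agree hagτ (by decide)) hb9 (S := Finset.univ.erase e) (by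
    have : τ.var 2 = (e : ℕ) := by
      simp only [hτ, run, Expr.eval, State.setVar_var, if_true]
      rw [run_var (by decide), hs]
    rw [this, admitted_coe])
  have hrun : (copyB ;; assign 2 (.var 4) ;; maxSize ;;
      storeTest 17 (.var 4) (.not (.eq (.var 3) (.var 5)))).run s =
      (storeTest 17 (.var 4) (.not (.eq (.var 3) (.var 5)))).run (maxSize.run τ) := rfl
  have ag : Agree _ _ τ (maxSize.run τ) := maxSize.run_agree τ
  have e4 : (maxSize.run τ).var 4 = (e : ℕ) := by
    rw [ag.1 4 (by decide), hagτ.1 4 (by decide), hs]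
  have e5 : (maxSize.run τ).var 5 = M.card := by
    rw [ag.1 5 (by decide), hagτ.1 5 (by decide), hag.1 5 (by decide), h5]
  rw [hrun, run_storeTest]
  simp only [Test.Holds, Expr.eval, e4, e5, hc, State.setArr_arr, true_and, if_true, Nat.cast_inj]
  refine ⟨isTruthValue_ite (inevitable_iff hM hN).symm, fun j hj => ?_⟩
  rw [if_neg hj, ag.2 17 (by decide), hagτ.2 17 (by decide)]

/-- Copy the map `b`, diminished at the ends of the edge in variable `4`, to array `9`, and exclude
this edge. -/
def dropEdge : LProg :=
  copyB ;; store 9 (.load 2 (.var 4)) (.sub (.load 9 (.load 2 (.var 4))) (.const 1)) ;;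
    store 9 (.load 3 (.var 4)) (.sub (.load 9 (.load 3 (.var 4))) (.const 1)) ;;
    assign 2 (.var 4)

/-- Compute the indicator of the allowed edges, in array `18`. -/
def allowedArray : LProg :=
  loop 4 1 (ite (.and (.lt (.const 0) (.load 0 (.load 2 (.var 4))))
      (.lt (.const 0) (.load 0 (.load 3 (.var 4)))))
    (dropEdge ;; maxSize ;; storeTest 18 (.var 4) (.eq (.add (.var 3) (.const 1)) (.var 5)))
    (store 18 (.var 4) (.const 0)))

/-- The ends have different colors, hence are distinct, so the two decrements affect different
cells. -/
theorem run_dropEdge {x : BMatchingInstance} {σ : State} (h : x.Holds σ) {e : Fin x.m}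
    (he : σ.var 4 = (e : ℕ)) (hA : 0 < x.b (x.G.endA e)) (hB : 0 < x.b (x.G.endB e)) :
    (dropEdge.run σ).var 2 = (e : ℕ) ∧ ∀ w : Fin x.n, (dropEdge.run σ).arr 9 (w : ℕ) =
      ((if x.G.endA e = w ∨ x.G.endB e = w then x.b w - 1 else x.b w : ℕ) : ℤ) := by
  have hag : Agree _ _ σ (copyB.run σ) := copyB.run_agree σ
  have e4 : (copyB.run σ).var 4 = (e : ℕ) := by rw [hag.1 4 (by decide), he]
  have e2 : (copyB.run σ).arr 2 (e : ℕ) = (x.G.endA e : ℕ) := by rw [hag.2 2 (by decide), h.arr2]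
  have e3 : (copyB.run σ).arr 3 (e : ℕ) = (x.G.endB e : ℕ) := by rw [hag.2 3 (by decide), h.arr3]
  have hne : x.G.endA e ≠ x.G.endB e := x.G.endA_ne (x.G.color_endB e)
  refine ⟨by simp [dropEdge, run, Expr.eval, e4], fun w => ?_⟩
  simp only [dropEdge, run, Expr.eval, State.setVar_arr, State.setArr_arr, State.setArr_var, e4, e2,
    e3, Nat.reduceEqDiff, false_and, if_false, true_and, run_copyB h, Nat.cast_inj, ← Fin.ext_iff,
    hne.symm]
  by_cases hwB : w = x.G.endB e
  · subst hwB; simp; omega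
  · by_cases hwA : w = x.G.endA e
    · subst hwA; simp [hne]; omega
    · simp [hwA, hwB, Ne.symm hwA, Ne.symm hwB]

theorem run_allowedArray {x : BMatchingInstance} {σ : State} (h : x.Holds σ)
    {M : Finset (Fin x.m)} (hM : x.G.IsMaxIn Finset.univ x.b M) (h5 : σ.var 5 = M.card)
    (e : Fin x.m) :
    IsTruthValue ((allowedArray.run σ).arr 18 (e : ℕ)) (x.G.Allowed x.b e) := by
  refine loop_fill h.var1 (fun e z => IsTruthValue z (x.G.Allowed x.b e)) ?_ e
  intro e s hs hag
  have hs' := h.agree hag (by decide)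
  by_cases hv : 0 < x.b (x.G.endA e) ∧ 0 < x.b (x.G.endB e)
  · set τ := dropEdge.run s with hτ
    have hagτ : Agree _ _ s τ := dropEdge.run_agree s
    obtain ⟨hd2, hd9⟩ := run_dropEdge hs' hs hv.1 hv.2
    obtain ⟨N, hN, hc⟩ := run_maxSize (hs'.agree hagτ (by decide)) hd9
      (by rw [hd2, admitted_coe])
    have hrun : ∀ Q, (ite (.and (.lt (.const 0) (.load 0 (.load 2 (.var 4))))
        (.lt (.const 0) (.load 0 (.load 3 (.var 4))))) (dropEdge ;; maxSize ;;
          storeTest 18 (.var 4) (.eq (.add (.var 3) (.const 1)) (.var 5))) Q).run s =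
        (storeTest 18 (.var 4) (.eq (.add (.var 3) (.const 1)) (.var 5))).run (maxSize.run τ) := by
      intro Q
      simp [run, Test.Holds, Expr.eval, hs, hs'.arr0, hs'.arr2, hs'.arr3, hv, hτ]
    have ag : Agree _ _ τ (maxSize.run τ) := maxSize.run_agree τ
    have e4 : (maxSize.run τ).var 4 = (e : ℕ) := by
      rw [ag.1 4 (by decide), hagτ.1 4 (by decide), hs]
    have e5 : (maxSize.run τ).var 5 = M.card := by
      rw [ag.1 5 (by decide), hagτ.1 5 (by decide), hag.1 5 (by decide), h5]
    rw [hrun, run_storeTest]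
    simp only [Test.Holds, Expr.eval, e4, e5, hc, State.setArr_arr, true_and, if_true]
    refine ⟨isTruthValue_ite ?_, fun j hj => ?_⟩
    · rw [allowed_iff hM hv.1 hv.2 (fun _ => rfl) hN]
      norm_cast
    · rw [if_neg hj, ag.2 18 (by decide), hagτ.2 18 (by decide)]
  · have hrun : ∀ P, (ite (.and (.lt (.const 0) (.load 0 (.load 2 (.var 4))))
        (.lt (.const 0) (.load 0 (.load 3 (.var 4))))) P
        (store 18 (.var 4) (.const 0))).run s = s.setArr 18 (e : ℕ) 0 := by
      intro P
      simp only [run, Test.Holds, Expr.eval, hs, hs'.arr0, hs'.arr2, hs'.arr3]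
      rw [if_neg (by exact_mod_cast hv)]
    rw [hrun]
    simp only [State.setArr_arr, true_and, if_true]
    exact ⟨Or.inr ⟨fun h => hv (pos_of_allowed h), rfl⟩, fun j hj => if_neg hj⟩

/-! ### Relations as matrices -/

/-- The array `a` holds the matrix of the relation `R`. -/
def IsMatrix {n : ℕ} (σ : State) (a : ℕ) (R : Fin n → Fin n → Prop) : Prop :=
  ∀ u v : Fin n, IsTruthValue (σ.arr a ((u : ℕ) * n + (v : ℕ))) (R u v)

theorem IsMatrix.congr {n : ℕ} {σ : State} {a : ℕ} {R R' : Fin n → Fin n → Prop}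
    (h : IsMatrix σ a R) (hR : ∀ u v, R u v ↔ R' u v) : IsMatrix σ a R' :=
  fun u v => (h u v).congr (hR u v)

theorem IsMatrix.setArr {n : ℕ} {σ : State} {a : ℕ} {R R' : Fin n → Fin n → Prop}
    (h : IsMatrix σ a R) {p q : Fin n} (hR : ∀ u v, R' u v ↔ R u v ∨ (u = p ∧ v = q)) :
    IsMatrix (σ.setArr a ((p : ℕ) * n + (q : ℕ)) 1) a R' := by
  intro u v
  simp only [State.setArr_arr, true_and, row_major_inj, ← Fin.ext_iff]
  split_ifs with hc
  · exact Or.inl ⟨(hR u v).2 (Or.inr hc), rfl⟩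
  · exact (h u v).congr (by rw [hR, or_iff_left hc])

theorem IsMatrix.of_eq {n : ℕ} {σ τ : State} {a : ℕ} {R : Fin n → Fin n → Prop}
    (h : IsMatrix σ a R) (hτ : τ.arr a = σ.arr a) : IsMatrix τ a R := by
  intro u v; rw [hτ]; exact h u v

/-- Set the diagonal of a matrix. -/
def diagonal (a : ℕ) : LProg := loop 4 0 (store a (.add (.load 15 (.var 4)) (.var 4)) (.const 1))

theorem run_diagonal {n a : ℕ} {σ : State} (h0 : σ.var 0 = n)
    (h15 : ∀ v : Fin n, σ.arr 15 (v : ℕ) = (v : ℕ) * n) (ha : 15 ≠ a)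
    (hz : σ.arr a = fun _ => 0) :
    IsMatrix ((diagonal a).run σ) a fun u v : Fin n => u = v := by
  have key := loop_induction (x := 4) (P := store a (.add (.load 15 (.var 4)) (.var 4)) (.const 1))
    h0 (fun j s => IsMatrix s a fun u v : Fin n => u = v ∧ (u : ℕ) < j) (fun _ _ _ h => h)
    (fun u v => Or.inr ⟨by simp, by rw [hz]⟩) (by
      intro j s hs hag hI
      simp only [run, Expr.eval, hs]
      rw [hag.2 15 (by simpa [arrs] using ha), h15]
      refine hI.setArr fun u v => ?_
      constructor
      · rintro ⟨rfl, h⟩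
        by_cases hu : u = j
        · exact Or.inr ⟨hu, hu⟩
        · exact Or.inl ⟨rfl, by have := fun h => hu (Fin.ext h); omega⟩
      · rintro (⟨rfl, h⟩ | ⟨rfl, rfl⟩)
        · exact ⟨rfl, by omega⟩
        · exact ⟨rfl, by omega⟩)
  exact key.congr fun u v => and_iff_left u.2

/-- Add to a matrix the arcs from the ends in array `c` to the ends in array `d` of the edges that
pass the test. -/
def addArcs (a c d : ℕ) (t : Test) : LProg :=
  loop 4 1 (ite t (store a (.add (.load 15 (.load c (.var 4))) (.load d (.var 4))) (.const 1)) skip)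

theorem run_addArcs {n m a c d : ℕ} {t : Test} {σ : State} (h1 : σ.var 1 = m)
    (h15 : ∀ v : Fin n, σ.arr 15 (v : ℕ) = (v : ℕ) * n) (ha : 15 ≠ a) (hca : c ≠ a) (hda : d ≠ a)
    {f g : Fin m → Fin n} (hf : ∀ e : Fin m, σ.arr c (e : ℕ) = (f e : ℕ))
    (hg : ∀ e : Fin m, σ.arr d (e : ℕ) = (g e : ℕ)) {p : Fin m → Prop}
    (hp : ∀ (e : Fin m) (s : State), s.var 4 = (e : ℕ) → Agree [4] [a] σ s → (t.Holds s ↔ p e))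
    {R : Fin n → Fin n → Prop} (hR : IsMatrix σ a R) :
    IsMatrix ((addArcs a c d t).run σ) a fun u v => R u v ∨ ∃ e, f e = u ∧ g e = v ∧ p e := by
  have key := loop_induction (x := 4)
    (P := ite t (store a (.add (.load 15 (.load c (.var 4))) (.load d (.var 4))) (.const 1)) skip)
    h1 (fun j s => IsMatrix s a fun u v : Fin n =>
      R u v ∨ ∃ e : Fin m, (e : ℕ) < j ∧ f e = u ∧ g e = v ∧ p e) (fun _ _ _ h => h)
    (hR.congr (by simp)) (by
      intro j s hs hag hI
      have hag' : Agree [4] [a] σ s := hag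
      have hpj := hp j s hs hag'
      by_cases hpp : p j
      · have hrun : ∀ Q, (ite t (store a (.add (.load 15 (.load c (.var 4))) (.load d (.var 4)))
            (.const 1)) Q).run s = s.setArr a ((f j : ℕ) * n + (g j : ℕ)) 1 := by
          intro Q
          simp only [run, hpj.2 hpp, if_true, Expr.eval, hs]
          rw [hag'.2 15 (by simpa using ha), hag'.2 c (by simpa using hca),
            hag'.2 d (by simpa using hda), hf, hg, h15]
        rw [hrun]
        refine hI.setArr fun u v => ?_
        rw [or_assoc]
        refine or_congr_right ⟨?_, ?_⟩
        · rintro ⟨e, he, rfl, rfl, hpe⟩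
          by_cases hej : e = j
          · exact Or.inr (by rw [hej]; exact ⟨rfl, rfl⟩)
          · exact Or.inl ⟨e, by have := fun h => hej (Fin.ext h); omega, rfl, rfl, hpe⟩
        · rintro (⟨e, he, h⟩ | ⟨rfl, rfl⟩)
          · exact ⟨e, by omega, h⟩
          · exact ⟨j, by omega, rfl, rfl, hpp⟩
      · have hrun : ∀ P, (ite t P skip).run s = s := by
          intro P
          simp [run, mt hpj.1 hpp]
        rw [hrun]
        refine hI.congr fun u v => or_congr_right ⟨?_, ?_⟩
        · rintro ⟨e, he, h⟩
          exact ⟨e, by omega, h⟩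
        · rintro ⟨e, he, h⟩
          have : e ≠ j := fun hej => hpp (hej ▸ h.2.2)
          exact ⟨e, by have := fun h => this (Fin.ext h); omega, h⟩)
  exact key.congr fun u v => or_congr_right (exists_congr fun e => and_iff_right e.2)

/-- Replace the relation in a matrix by its transitive closure (Warshall's algorithm). -/
def closure (a : ℕ) : LProg :=
  loop 7 0 (loop 8 0 (loop 9 0 (ite (.and
      (.eq (.load a (.add (.load 15 (.var 8)) (.var 7))) (.const 1))
      (.eq (.load a (.add (.load 15 (.var 7)) (.var 9))) (.const 1)))
    (store a (.add (.load 15 (.var 8)) (.var 9)) (.const 1)) skip)))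

/-- One step of Warshall's algorithm, for the pivot in variable `7`. -/
theorem run_closure_pivot {n a : ℕ} {σ : State} (h0 : σ.var 0 = n)
    (h15 : ∀ v : Fin n, σ.arr 15 (v : ℕ) = (v : ℕ) * n) (ha : 15 ≠ a) {k : Fin n}
    (hk : σ.var 7 = (k : ℕ)) {R : Fin n → Fin n → Prop} (hR : IsMatrix σ a R) :
    IsMatrix ((loop 8 0 (loop 9 0 (ite (.and
      (.eq (.load a (.add (.load 15 (.var 8)) (.var 7))) (.const 1))
      (.eq (.load a (.add (.load 15 (.var 7)) (.var 9))) (.const 1)))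
      (store a (.add (.load 15 (.var 8)) (.var 9)) (.const 1)) skip))).run σ) a
      fun u v => R u v ∨ (R u k ∧ R k v) := by
  have key := loop_induction (x := 8) (P := loop 9 0 (ite (.and
      (.eq (.load a (.add (.load 15 (.var 8)) (.var 7))) (.const 1))
      (.eq (.load a (.add (.load 15 (.var 7)) (.var 9))) (.const 1)))
      (store a (.add (.load 15 (.var 8)) (.var 9)) (.const 1)) skip)) h0
    (fun i s => IsMatrix s a fun u v => R u v ∨ ((u : ℕ) < i ∧ R u k ∧ R k v)) (fun _ _ _ h => h)
    (hR.congr (by simp)) (by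
      intro i s hs hag hI
      have s0 : s.var 0 = n := by rw [hag.1 0 (by simp [vars]), h0]
      have hstep := loop_induction (x := 9) (P := ite (.and
        (.eq (.load a (.add (.load 15 (.var 8)) (.var 7))) (.const 1))
        (.eq (.load a (.add (.load 15 (.var 7)) (.var 9))) (.const 1)))
        (store a (.add (.load 15 (.var 8)) (.var 9)) (.const 1)) skip) s0
        (fun j r => IsMatrix r a fun u v =>
          R u v ∨ (((u : ℕ) < i ∨ (u = i ∧ (v : ℕ) < j)) ∧ R u k ∧ R k v)) (fun _ _ _ h => h)
        (hI.congr (by simp)) (by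
          intro j r hr hag' hJ
          have r7 : r.var 7 = (k : ℕ) := by rw [hag'.1 7 (by simp [vars]), hag.1 7 (by simp [vars]), hk]
          have r8 : r.var 8 = (i : ℕ) := by rw [hag'.1 8 (by simp [vars]), hs]
          have r15 : ∀ v : Fin n, r.arr 15 (v : ℕ) = (v : ℕ) * n := by
            rw [hag'.2 15 (by simpa [arrs] using ha), hag.2 15 (by simpa [arrs] using ha)]
            exact h15
          have htest : Test.Holds r (.and
              (.eq (.load a (.add (.load 15 (.var 8)) (.var 7))) (.const 1))
              (.eq (.load a (.add (.load 15 (.var 7)) (.var 9))) (.const 1))) ↔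
              R i k ∧ R k j := by
            simp only [Test.Holds, Expr.eval, r7, r8, hr, r15]
            -- Updating in place is harmless: the row and the column of the pivot do not change,
            -- since `R u k ∨ (R u k ∧ R k k)` is just `R u k`, and likewise for `R k v`.
            rw [(hJ i k).eq_one_iff, (hJ k j).eq_one_iff]
            tauto
          by_cases hc : R i k ∧ R k j
          · have hrun : ∀ Q, (ite (.and
                (.eq (.load a (.add (.load 15 (.var 8)) (.var 7))) (.const 1))
                (.eq (.load a (.add (.load 15 (.var 7)) (.var 9))) (.const 1)))
                (store a (.add (.load 15 (.var 8)) (.var 9)) (.const 1)) Q).run r =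
                r.setArr a ((i : ℕ) * n + (j : ℕ)) 1 := by
              intro Q
              simp only [run, htest.2 hc, if_true, Expr.eval, r8, hr, r15]
            rw [hrun]
            refine hJ.setArr fun u v => ?_
            constructor
            · rintro (h | ⟨h | ⟨rfl, h⟩, h'⟩)
              · exact Or.inl (Or.inl h)
              · exact Or.inl (Or.inr ⟨Or.inl h, h'⟩)
              · by_cases hv : v = j
                · exact Or.inr ⟨rfl, hv⟩
                · exact Or.inl (Or.inr ⟨Or.inr ⟨rfl, by
                    have := fun h => hv (Fin.ext h); omega⟩, h'⟩)
            · rintro ((h | ⟨h | ⟨rfl, h⟩, h'⟩) | ⟨rfl, rfl⟩)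
              · exact Or.inl h
              · exact Or.inr ⟨Or.inl h, h'⟩
              · exact Or.inr ⟨Or.inr ⟨rfl, by omega⟩, h'⟩
              · exact Or.inr ⟨Or.inr ⟨rfl, by omega⟩, hc⟩
          · have hrun : ∀ P, (ite (.and
                (.eq (.load a (.add (.load 15 (.var 8)) (.var 7))) (.const 1))
                (.eq (.load a (.add (.load 15 (.var 7)) (.var 9))) (.const 1)))
                P skip).run r = r := by
              intro P
              simp only [run, mt htest.1 hc, if_false]
            rw [hrun]
            refine hJ.congr fun u v => or_congr_right (and_congr_left fun h => ?_)
            refine or_congr_right (and_congr_right fun hu => ⟨fun h => by omega, fun hv => ?_⟩)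
            have : v ≠ j := fun hvj => hc (hu ▸ hvj ▸ h)
            have := fun h => this (Fin.ext h)
            omega)
      refine hstep.congr fun u v => or_congr_right (and_congr_left fun _ => ?_)
      constructor
      · rintro (h | ⟨rfl, -⟩) <;> omega
      · intro h
        by_cases hu : u = i
        · exact Or.inr ⟨hu, v.2⟩
        · exact Or.inl (by have := fun h => hu (Fin.ext h); omega))
  exact key.congr fun u v => or_congr_right (and_iff_right u.2)

/-- The matrix always lies between `R` and the closure of `Q`, and composition through pivots
already treated stays inside it. After all pivots it is transitive. -/
theorem run_closure {n a : ℕ} {σ : State} (h0 : σ.var 0 = n)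
    (h15 : ∀ v : Fin n, σ.arr 15 (v : ℕ) = (v : ℕ) * n) (ha : 15 ≠ a)
    {R Q : Fin n → Fin n → Prop} (hR : IsMatrix σ a R) (hRQ : ∀ u v, R u v ↔ u = v ∨ Q u v) :
    IsMatrix ((closure a).run σ) a (Relation.ReflTransGen Q) := by
  have key := loop_induction (x := 7) (P := loop 8 0 (loop 9 0 (ite (.and
      (.eq (.load a (.add (.load 15 (.var 8)) (.var 7))) (.const 1))
      (.eq (.load a (.add (.load 15 (.var 7)) (.var 9))) (.const 1)))
      (store a (.add (.load 15 (.var 8)) (.var 9)) (.const 1)) skip))) h0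
    (fun i s => ∃ T, IsMatrix s a T ∧ (∀ u v, R u v → T u v) ∧
      (∀ u v, T u v → Relation.ReflTransGen Q u v) ∧
      ∀ k : Fin n, (k : ℕ) < i → ∀ u v, T u k → T k v → T u v) (fun _ _ _ h => h)
    ⟨R, hR, fun _ _ h => h, fun u v h => by
      rcases (hRQ u v).1 h with rfl | h
      exacts [.refl, .single h], fun k hk => absurd hk (by omega)⟩ (by
      rintro k s hs hag ⟨T, hT, hRT, hTQ, hpiv⟩
      have s0 : s.var 0 = n := by rw [hag.1 0 (by simp [vars]), h0]
      have s15 : ∀ v : Fin n, s.arr 15 (v : ℕ) = (v : ℕ) * n := by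
        rw [hag.2 15 (by simpa [arrs] using ha)]; exact h15
      refine ⟨_, run_closure_pivot s0 s15 ha hs hT, fun u v h => Or.inl (hRT u v h), ?_, ?_⟩
      · rintro u v (h | ⟨h, h'⟩)
        exacts [hTQ u v h, (hTQ _ _ h).trans (hTQ _ _ h')]
      · intro l hl u v
        by_cases hlk : l = k
        · subst hlk; tauto
        -- Closure at the earlier pivot `l` survives the new pivot `k`: a pair entering or leaving
        -- `l` may itself be composed through `k`, and these four instances cover all combinations.
        · have hp := hpiv l (by have := fun h => hlk (Fin.ext h); omega)
          have h1 := hp u v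
          have h2 := hp u k
          have h3 := hp k v
          have h4 := hp k k
          tauto)
  obtain ⟨T, hT, hRT, hTQ, hpiv⟩ := key
  refine hT.congr fun u v => ⟨hTQ u v, fun h => ?_⟩
  induction h with
  | refl => exact hRT _ _ ((hRQ _ _).2 (Or.inl rfl))
  | @tail p q _ hpq ih => exact hpiv p p.2 _ _ ih (hRT _ _ ((hRQ _ _).2 (Or.inr hpq)))

/-- Compute the matrix whose rows are the indicators of the flexible components, in array `19`. -/
def componentMatrix : LProg :=
  diagonal 19 ;;
  addArcs 19 2 3 (.and (.eq (.load 18 (.var 4)) (.const 1))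
    (.eq (.load 17 (.var 4)) (.const 0))) ;;
  addArcs 19 3 2 (.and (.eq (.load 18 (.var 4)) (.const 1))
    (.eq (.load 17 (.var 4)) (.const 0))) ;;
  closure 19

theorem run_componentMatrix {x : BMatchingInstance} {σ : State} (h : x.Holds σ)
    (h15 : ∀ v : Fin x.n, σ.arr 15 (v : ℕ) = (v : ℕ) * x.n) (hz : σ.arr 19 = fun _ => 0)
    (hin : ∀ e : Fin x.m, IsTruthValue (σ.arr 17 (e : ℕ)) (x.G.Inevitable x.b e))
    (hal : ∀ e : Fin x.m, IsTruthValue (σ.arr 18 (e : ℕ)) (x.G.Allowed x.b e)) :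
    IsMatrix (componentMatrix.run σ) 19 fun u v : Fin x.n => v ∈ x.G.flexComp x.b u := by
  set t : Test := .and (.eq (.load 18 (.var 4)) (.const 1)) (.eq (.load 17 (.var 4)) (.const 0))
    with ht
  set σ₁ := (diagonal 19).run σ with h₁
  set σ₂ := (addArcs 19 2 3 t).run σ₁ with h₂
  set σ₃ := (addArcs 19 3 2 t).run σ₂ with h₃
  have hrun : componentMatrix.run σ = (closure 19).run σ₃ := rfl
  have ag₁ : Agree [4] [19] σ σ₁ := (diagonal 19).run_agree σ
  have ag₂ : Agree [4] [19] σ₁ σ₂ := (addArcs 19 2 3 t).run_agree σ₁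
  have ag₃ : Agree [4] [19] σ₂ σ₃ := (addArcs 19 3 2 t).run_agree σ₂
  have ag₁₂ := ag₁.trans ag₂
  have ag₁₃ := ag₁₂.trans ag₃
  have hh₁ := h.agree ag₁ (by decide)
  have hh₂ := h.agree ag₁₂ (by decide)
  have hh₃ := h.agree ag₁₃ (by decide)
  have h15' : ∀ τ : State, τ.arr 15 = σ.arr 15 →
      ∀ v : Fin x.n, τ.arr 15 (v : ℕ) = (v : ℕ) * x.n := fun τ hτ => by rw [hτ]; exact h15
  have htest : ∀ (e : Fin x.m) (s : State), s.var 4 = (e : ℕ) → s.arr 17 = σ.arr 17 →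
      s.arr 18 = σ.arr 18 → (t.Holds s ↔ x.G.Flexible x.b e) := by
    intro e s hs e17 e18
    simp only [ht, Test.Holds, Expr.eval, hs, e17, e18]
    rw [(hin e).eq_zero_iff, (hal e).eq_one_iff]
    rfl
  have m₁ := run_diagonal h.var0 h15 (by decide) hz
  have m₂ := run_addArcs (t := t) (p := x.G.Flexible x.b) hh₁.var1
    (h15' _ (ag₁.2 15 (by decide))) (by decide) (by decide) (by decide) hh₁.arr2 hh₁.arr3 (by
      intro e s hs hag
      exact htest e s hs ((ag₁.trans hag).2 17 (by decide)) ((ag₁.trans hag).2 18 (by decide))) m₁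
  have m₃ := run_addArcs (t := t) (p := x.G.Flexible x.b) hh₂.var1
    (h15' _ (ag₁₂.2 15 (by decide))) (by decide) (by decide) (by decide) hh₂.arr3 hh₂.arr2 (by
      intro e s hs hag
      exact htest e s hs ((ag₁₂.trans hag).2 17 (by decide))
        ((ag₁₂.trans hag).2 18 (by decide))) m₂
  rw [hrun]
  refine run_closure hh₃.var0 (h15' _ (ag₁₃.2 15 (by decide))) (by decide) m₃ fun u v => ?_
  rw [or_assoc]
  refine or_congr_right ⟨?_, ?_⟩
  · rintro (⟨e, h1, h2, h3⟩ | ⟨e, h1, h2, h3⟩)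
    · exact ⟨e, h3, Or.inl ⟨h1, h2⟩⟩
    · exact ⟨e, h3, Or.inr ⟨h1, h2⟩⟩
  · rintro ⟨e, h3, ⟨h1, h2⟩ | ⟨h1, h2⟩⟩
    · exact Or.inl ⟨e, h1, h2, h3⟩
    · exact Or.inr ⟨e, h1, h2, h3⟩

/-- Compute the matrix of the order on the flexible components, in array `5`. -/
def orderMatrix : LProg :=
  diagonal 5 ;;
  addArcs 5 2 3 (.eq (.load 18 (.var 4)) (.const 1)) ;;
  addArcs 5 3 2 (.eq (.load 17 (.var 4)) (.const 0)) ;;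
  closure 5

/-- The arcs entered are those of `Arc`, so `flexLE_iff` identifies the closure; the components need
not be contracted. -/
theorem run_orderMatrix {x : BMatchingInstance} {σ : State} (h : x.Holds σ)
    (h15 : ∀ v : Fin x.n, σ.arr 15 (v : ℕ) = (v : ℕ) * x.n) (hz : σ.arr 5 = fun _ => 0)
    (hin : ∀ e : Fin x.m, IsTruthValue (σ.arr 17 (e : ℕ)) (x.G.Inevitable x.b e))
    (hal : ∀ e : Fin x.m, IsTruthValue (σ.arr 18 (e : ℕ)) (x.G.Allowed x.b e)) :
    IsMatrix (orderMatrix.run σ) 5 fun u v : Fin x.n =>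
      x.G.FlexLE x.b x.G.A (x.G.flexCompOf x.b u) (x.G.flexCompOf x.b v) := by
  set σ₁ := (diagonal 5).run σ with h₁
  set σ₂ := (addArcs 5 2 3 (.eq (.load 18 (.var 4)) (.const 1))).run σ₁ with h₂
  set σ₃ := (addArcs 5 3 2 (.eq (.load 17 (.var 4)) (.const 0))).run σ₂ with h₃
  have hrun : orderMatrix.run σ = (closure 5).run σ₃ := rfl
  have ag₁ : Agree [4] [5] σ σ₁ := (diagonal 5).run_agree σ
  have ag₂ : Agree [4] [5] σ₁ σ₂ :=
    (addArcs 5 2 3 (.eq (.load 18 (.var 4)) (.const 1))).run_agree σ₁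
  have ag₃ : Agree [4] [5] σ₂ σ₃ :=
    (addArcs 5 3 2 (.eq (.load 17 (.var 4)) (.const 0))).run_agree σ₂
  have ag₁₂ := ag₁.trans ag₂
  have ag₁₃ := ag₁₂.trans ag₃
  have hh₁ := h.agree ag₁ (by decide)
  have hh₂ := h.agree ag₁₂ (by decide)
  have hh₃ := h.agree ag₁₃ (by decide)
  have h15' : ∀ τ : State, τ.arr 15 = σ.arr 15 →
      ∀ v : Fin x.n, τ.arr 15 (v : ℕ) = (v : ℕ) * x.n := fun τ hτ => by rw [hτ]; exact h15
  have m₁ := run_diagonal h.var0 h15 (by decide) hz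
  have m₂ := run_addArcs (t := .eq (.load 18 (.var 4)) (.const 1)) (p := x.G.Allowed x.b) hh₁.var1
    (h15' _ (ag₁.2 15 (by decide))) (by decide) (by decide) (by decide) hh₁.arr2 hh₁.arr3 (by
      intro e s hs hag
      simp only [Test.Holds, Expr.eval, hs]
      rw [(ag₁.trans hag).2 18 (by decide)]
      exact (hal e).eq_one_iff) m₁
  have m₃ := run_addArcs (t := .eq (.load 17 (.var 4)) (.const 0))
    (p := fun e => ¬ x.G.Inevitable x.b e) hh₂.var1
    (h15' _ (ag₁₂.2 15 (by decide))) (by decide) (by decide) (by decide) hh₂.arr3 hh₂.arr2 (by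
      intro e s hs hag
      simp only [Test.Holds, Expr.eval, hs]
      rw [(ag₁₂.trans hag).2 17 (by decide)]
      exact (hin e).eq_zero_iff) m₂
  rw [hrun]
  refine (run_closure (Q := x.G.Arc x.b) hh₃.var0 (h15' _ (ag₁₃.2 15 (by decide))) (by decide) m₃
    fun u v => ?_).congr fun u v => flexLE_iff.symm
  rw [or_assoc]
  exact or_congr_right exists_or.symm

/-! ### Labels and types of the components -/

/-- Label every vertex with the last vertex of its component, in array `4`. -/
def labels : LProg :=
  loop 4 0 (loop 7 0 (ite (.eq (.load 19 (.add (.load 15 (.var 4)) (.var 7))) (.const 1))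
    (store 4 (.var 4) (.var 7)) skip))

/-- The label is the largest vertex of the component, because later stores overwrite earlier ones.
It is the same for all members and lies in the component, so it determines it. -/
theorem run_labels {x : BMatchingInstance} {σ : State} (h : x.Holds σ)
    (h15 : ∀ v : Fin x.n, σ.arr 15 (v : ℕ) = (v : ℕ) * x.n)
    (hF : IsMatrix σ 19 fun u v : Fin x.n => v ∈ x.G.flexComp x.b u) (u v : Fin x.n) :
    (labels.run σ).arr 4 (u : ℕ) = (labels.run σ).arr 4 (v : ℕ) ↔
      x.G.flexComp x.b u = x.G.flexComp x.b v := by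
  have key : ∀ v : Fin x.n, ∃ w ∈ x.G.flexComp x.b v, (labels.run σ).arr 4 (v : ℕ) = (w : ℕ) ∧
      ∀ w' ∈ x.G.flexComp x.b v, w' ≤ w := by
    intro v
    refine loop_fill (x := 4) h.var0 (fun v z => ∃ w ∈ x.G.flexComp x.b v, z = (w : ℕ) ∧
      ∀ w' ∈ x.G.flexComp x.b v, w' ≤ w) ?_ v
    intro v s hs hag
    have hs' := h.agree hag (by decide)
    have hloop := loop_induction (x := 7)
      (P := ite (.eq (.load 19 (.add (.load 15 (.var 4)) (.var 7))) (.const 1))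
        (store 4 (.var 4) (.var 7)) skip) hs'.var0
      -- The second alternative, that no member has been met yet, is excluded at the end by `v`
      -- itself.
      (fun j r => ((∃ w ∈ x.G.flexComp x.b v, (w : ℕ) < j ∧ r.arr 4 (v : ℕ) = (w : ℕ) ∧
        ∀ w' ∈ x.G.flexComp x.b v, (w' : ℕ) < j → w' ≤ w) ∨
        ∀ w' ∈ x.G.flexComp x.b v, ¬ (w' : ℕ) < j) ∧
        ∀ i, i ≠ ((v : ℕ) : ℤ) → r.arr 4 i = s.arr 4 i) (fun _ _ _ h => h)
      ⟨Or.inr fun _ _ h => absurd h (by omega), fun _ _ => rfl⟩ (by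
        rintro j r hr hag' ⟨hI, hframe⟩
        have htest : Test.Holds r (.eq (.load 19 (.add (.load 15 (.var 4)) (.var 7))) (.const 1)) ↔
            j ∈ x.G.flexComp x.b v := by
          simp only [Test.Holds, Expr.eval, hr]
          rw [hag'.1 4 (by decide), hag'.2 19 (by decide), hag'.2 15 (by decide),
            hag.2 19 (by decide), hag.2 15 (by decide), hs, h15]
          exact (hF v j).eq_one_iff
        by_cases hj : j ∈ x.G.flexComp x.b v
        · have hrun : ∀ Q, (ite (.eq (.load 19 (.add (.load 15 (.var 4)) (.var 7))) (.const 1))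
              (store 4 (.var 4) (.var 7)) Q).run r = r.setArr 4 (v : ℕ) (j : ℕ) := by
            intro Q
            simp only [run, htest.2 hj, if_true, Expr.eval, hr]
            rw [hag'.1 4 (by decide), hs]
          rw [hrun]
          simp only [State.setArr_arr, true_and, if_true]
          exact ⟨Or.inl ⟨j, hj, by omega, rfl, fun w' _ hw' => Fin.le_def.2 (by omega)⟩,
            fun i hi => by rw [if_neg hi]; exact hframe i hi⟩
        · have hrun : ∀ P, (ite (.eq (.load 19 (.add (.load 15 (.var 4)) (.var 7))) (.const 1))
              P skip).run r = r := by
            intro P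
            simp only [run, mt htest.1 hj, if_false]
          rw [hrun]
          have hne : ∀ w' ∈ x.G.flexComp x.b v, (w' : ℕ) < j + 1 → (w' : ℕ) < j := by
            intro w' hw' hlt
            have : w' ≠ j := fun h => hj (h ▸ hw')
            have := fun h => this (Fin.ext h)
            omega
          refine ⟨?_, hframe⟩
          rcases hI with ⟨w, hw, hwj, hrw, hmax⟩ | hI
          · exact Or.inl ⟨w, hw, by omega, hrw, fun w' hw' hlt => hmax w' hw' (hne w' hw' hlt)⟩
          · exact Or.inr fun w' hw' hlt => hI w' hw' (hne w' hw' hlt))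
    refine ⟨?_, hloop.2⟩
    rcases hloop.1 with ⟨w, hw, -, hrw, hmax⟩ | hI
    · exact ⟨w, hw, hrw, fun w' hw' => hmax w' hw' w'.2⟩
    · exact absurd v.2 (hI v (mem_flexComp_self v))
  obtain ⟨w, hw, hu, hmax⟩ := key u
  obtain ⟨w', hw', hv, hmax'⟩ := key v
  rw [hu, hv]
  constructor
  · intro heq
    have : w = w' := Fin.ext (by exact_mod_cast heq)
    subst this
    rw [flexComp_eq_iff.2 hw, flexComp_eq_iff.2 hw']
  · intro heq
    rw [heq] at hw hmax
    rw [le_antisymm (hmax' w hw) (hmax w' hw')]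

/-- Compute, in array `o`, which vertices are in a component that contains a loose vertex of color
`k`, or have value `0` and are joined by an edge, with end in array `c`, to a loose vertex, the
other end in array `d`. -/
def hooked (o : ℕ) (k : ℤ) (c d : ℕ) : LProg :=
  loop 4 0 (
    count 6 7 0 (.and (.eq (.load 19 (.add (.load 15 (.var 4)) (.var 7))) (.const 1))
      (.and (.eq (.load 16 (.var 7)) (.const 1)) (.eq (.load 1 (.var 7)) (.const k)))) ;;
    count 8 7 1 (.and (.eq (.load 0 (.var 4)) (.const 0))
      (.and (.eq (.load c (.var 7)) (.var 4)) (.eq (.load 16 (.load d (.var 7))) (.const 1)))) ;;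
    storeTest o (.var 4) (.lt (.const 0) (.add (.var 6) (.var 8))))

/-- With the maps `f` and `g` for the two ends and the color `k` left open, one lemma serves both
color classes. The condition on `o` protects the arrays that are still read. -/
theorem run_hooked {x : BMatchingInstance} {σ : State} (h : x.Holds σ)
    (h15 : ∀ v : Fin x.n, σ.arr 15 (v : ℕ) = (v : ℕ) * x.n)
    (hF : IsMatrix σ 19 fun u v : Fin x.n => v ∈ x.G.flexComp x.b u)
    (hl : ∀ v : Fin x.n, IsTruthValue (σ.arr 16 (v : ℕ)) (v ∈ x.G.looseVertices x.b))
    {o c d : ℕ} {k : Bool} (ho : o ∉ [0, 1, 2, 3, 14, 15, 16, 19]) (hco : c ≠ o) (hdo : d ≠ o)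
    {f g : Fin x.m → Fin x.n} (hf : ∀ e : Fin x.m, σ.arr c (e : ℕ) = (f e : ℕ))
    (hg : ∀ e : Fin x.m, σ.arr d (e : ℕ) = (g e : ℕ)) (v : Fin x.n) :
    IsTruthValue (((hooked o (if k = true then 1 else 0) c d).run σ).arr o (v : ℕ))
      ((∃ u, u ∈ x.G.flexComp x.b v ∧ u ∈ x.G.looseVertices x.b ∧ x.G.color u = k) ∨
        ∃ e, x.b v = 0 ∧ f e = v ∧ g e ∈ x.G.looseVertices x.b) := by
  classical
  simp only [List.mem_cons, List.not_mem_nil, or_false, not_or] at ho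
  obtain ⟨o0, o1, o2, o3, o14, o15, o16, o19⟩ := ho
  refine loop_fill h.var0 (fun v z => IsTruthValue z
    ((∃ u, u ∈ x.G.flexComp x.b v ∧ u ∈ x.G.looseVertices x.b ∧ x.G.color u = k) ∨
      ∃ e, x.b v = 0 ∧ f e = v ∧ g e ∈ x.G.looseVertices x.b)) ?_ v
  intro v s hs hag
  have hag' : Agree [4, 6, 7, 8] [o] σ s := by
    refine ⟨fun z hz => hag.1 z ?_, fun a ha => hag.2 a ?_⟩
    · simp only [vars, count, storeTest, List.mem_cons, List.mem_append, List.not_mem_nil] at hz ⊢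
      tauto
    · simpa [arrs, count, storeTest] using ha
  have hframe : ∀ a, a ≠ o → s.arr a = σ.arr a := fun a ha => hag'.2 a (by simpa using ha)
  have hs' : x.Holds s := h.agree hag' (by simp [Ne.symm o0, Ne.symm o1, Ne.symm o2, Ne.symm o3,
    Ne.symm o14])
  set t₁ : Test := .and (.eq (.load 19 (.add (.load 15 (.var 4)) (.var 7))) (.const 1))
      (.and (.eq (.load 16 (.var 7)) (.const 1))
        (.eq (.load 1 (.var 7)) (.const (if k = true then 1 else 0)))) with ht₁
  set t₂ : Test := .and (.eq (.load 0 (.var 4)) (.const 0))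
      (.and (.eq (.load c (.var 7)) (.var 4)) (.eq (.load 16 (.load d (.var 7))) (.const 1)))
    with ht₂
  set s₁ := (count 6 7 0 t₁).run s with hs₁
  have ag₁ : Agree [6, 7, 6] [] s s₁ := (count 6 7 0 t₁).run_agree s
  have hs₁' : x.Holds s₁ := hs'.agree ag₁ (by decide)
  set s₂ := (count 8 7 1 t₂).run s₁ with hs₂
  have ag₂ : Agree [8, 7, 8] [] s₁ s₂ := (count 8 7 1 t₂).run_agree s₁
  have c₁ := run_count (c := 6) (x := 7) (t := t₁) hs'.var0 (by decide) (by decide)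
    (fun u : Fin x.n => u ∈ x.G.flexComp x.b v ∧ u ∈ x.G.looseVertices x.b ∧ x.G.color u = k) (by
      intro u r hr hagr
      have hfr : ∀ a, r.arr a = s.arr a := fun a => hagr.2 a (by simp)
      simp only [ht₁, Test.Holds, Expr.eval, hr, hfr, hagr.1 4 (by decide), hs, hs'.arr1,
        hframe 19 (Ne.symm o19), hframe 15 (Ne.symm o15), hframe 16 (Ne.symm o16), h15]
      rw [(hF v u).eq_one_iff, (hl u).eq_one_iff]
      refine and_congr_right fun _ => and_congr_right fun _ => ?_
      cases k <;> cases x.G.color u <;> simp)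
  have c₂ := run_count (c := 8) (x := 7) (t := t₂) hs₁'.var1 (by decide) (by decide)
    (fun e : Fin x.m => x.b v = 0 ∧ f e = v ∧ g e ∈ x.G.looseVertices x.b) (by
      intro e r hr hagr
      have hfr : ∀ a, r.arr a = s.arr a := fun a =>
        (hagr.2 a (by simp)).trans (ag₁.2 a (by simp))
      simp only [ht₂, Test.Holds, Expr.eval, hr, hfr, hagr.1 4 (by decide), ag₁.1 4 (by decide), hs,
        hs'.arr0, hframe c hco, hframe d hdo, hframe 16 (Ne.symm o16), hf, hg]
      rw [(hl (g e)).eq_one_iff]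
      simp [Fin.ext_iff])
  have e4 : s₂.var 4 = (v : ℕ) := by rw [ag₂.1 4 (by decide), ag₁.1 4 (by decide), hs]
  have e6 : s₂.var 6 = _ := (ag₂.1 6 (by decide)).trans c₁
  have hrun : (count 6 7 0 t₁ ;; count 8 7 1 t₂ ;;
      storeTest o (.var 4) (.lt (.const 0) (.add (.var 6) (.var 8)))).run s =
      (storeTest o (.var 4) (.lt (.const 0) (.add (.var 6) (.var 8)))).run s₂ := rfl
  rw [hrun, run_storeTest]
  simp only [Test.Holds, Expr.eval, e4, e6, show s₂.var 8 = _ from c₂, State.setArr_arr, true_and,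
    if_true]
  refine ⟨isTruthValue_ite ?_, fun j hj => ?_⟩
  -- The disjunction of two existence statements is the positivity of the sum of the two counts.
  · rw [← Nat.cast_add, Nat.cast_pos, Nat.add_pos_iff_pos_or_pos, Finset.card_pos, Finset.card_pos,
      Finset.filter_nonempty_iff, Finset.filter_nonempty_iff]
    simp
  · rw [if_neg hj, ag₂.2 o (by simp), ag₁.2 o (by simp)]

/-- Compute which vertices are in consistent components, in array `8`. -/
def consistent : LProg :=
  loop 4 0 (storeTest 8 (.var 4)
    (.and (.eq (.load 6 (.var 4)) (.const 0)) (.eq (.load 7 (.var 4)) (.const 0))))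

theorem run_consistent {n : ℕ} {σ : State} (h0 : σ.var 0 = n) {p q : Fin n → Prop}
    (hp : ∀ v : Fin n, IsTruthValue (σ.arr 6 (v : ℕ)) (p v))
    (hq : ∀ v : Fin n, IsTruthValue (σ.arr 7 (v : ℕ)) (q v)) (v : Fin n) :
    IsTruthValue ((consistent.run σ).arr 8 (v : ℕ)) (¬ (p v ∨ q v)) := by
  refine loop_fill h0 (fun v z => IsTruthValue z (¬ (p v ∨ q v))) ?_ v
  intro v s hs hag
  rw [run_storeTest]
  simp only [Test.Holds, Expr.eval, hs, State.setArr_arr, true_and, if_true]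
  refine ⟨isTruthValue_ite ?_, fun j hj => if_neg hj⟩
  rw [hag.2 6 (by decide), hag.2 7 (by decide), (hp v).eq_zero_iff, (hq v).eq_zero_iff, not_or]

/-! ### The complete program and its correctness. -/

/-- The program that computes the decomposition. -/
def decompose : LProg :=
  multiples ;; totalSize ;; looseArray ;; inevitableArray ;; allowedArray ;; componentMatrix ;;
    orderMatrix ;; labels ;; hooked 6 1 3 2 ;; hooked 7 0 2 3 ;; consistent

theorem holdsDecomposition_run (x : BMatchingInstance) :
    x.HoldsDecomposition (decompose.run x.input) := by
  set σ₁ := multiples.run x.input with h₁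
  set σ₂ := totalSize.run σ₁ with h₂
  set σ₃ := looseArray.run σ₂ with h₃
  set σ₄ := inevitableArray.run σ₃ with h₄
  set σ₅ := allowedArray.run σ₄ with h₅
  set σ₆ := componentMatrix.run σ₅ with h₆
  set σ₇ := orderMatrix.run σ₆ with h₇
  set σ₈ := labels.run σ₇ with h₈
  set σ₉ := (hooked 6 1 3 2).run σ₈ with h₉
  set σ₁₀ := (hooked 7 0 2 3).run σ₉ with h₁₀
  have hrun : decompose.run x.input = consistent.run σ₁₀ := rfl
  have ag₁ : Agree _ _ x.input σ₁ := multiples.run_agree _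
  have ag₂ : Agree _ _ σ₁ σ₂ := totalSize.run_agree _
  have ag₃ : Agree _ _ σ₂ σ₃ := looseArray.run_agree _
  have ag₄ : Agree _ _ σ₃ σ₄ := inevitableArray.run_agree _
  have ag₅ : Agree _ _ σ₄ σ₅ := allowedArray.run_agree _
  have ag₆ : Agree _ _ σ₅ σ₆ := componentMatrix.run_agree _
  have ag₇ : Agree _ _ σ₆ σ₇ := orderMatrix.run_agree _
  have ag₈ : Agree _ _ σ₇ σ₈ := labels.run_agree _
  have ag₉ : Agree _ _ σ₈ σ₉ := (hooked 6 1 3 2).run_agree _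
  have ag₁₀ : Agree _ _ σ₉ σ₁₀ := (hooked 7 0 2 3).run_agree _
  have ag₁₁ : Agree _ _ σ₁₀ (consistent.run σ₁₀) := consistent.run_agree _
  obtain ⟨hh₁, n₁⟩ := run_multiples x
  have hh₂ := hh₁.agree ag₂ (by decide)
  have hh₃ := hh₂.agree ag₃ (by decide)
  have hh₄ := hh₃.agree ag₄ (by decide)
  have hh₅ := hh₄.agree ag₅ (by decide)
  have hh₆ := hh₅.agree ag₆ (by decide)
  have hh₇ := hh₆.agree ag₇ (by decide)
  have hh₈ := hh₇.agree ag₈ (by decide)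
  have hh₉ := hh₈.agree ag₉ (by decide)
  have hh₁₀ := hh₉.agree ag₁₀ (by decide)
  have e₅ : σ₅.arr 15 = σ₁.arr 15 := by
    rw [ag₅.2 15 (by decide), ag₄.2 15 (by decide), ag₃.2 15 (by decide), ag₂.2 15 (by decide)]
  have e₆ : σ₆.arr 15 = σ₁.arr 15 := by rw [ag₆.2 15 (by decide), e₅]
  have e₇ : σ₇.arr 15 = σ₁.arr 15 := by rw [ag₇.2 15 (by decide), e₆]
  have e₈ : σ₈.arr 15 = σ₁.arr 15 := by rw [ag₈.2 15 (by decide), e₇]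
  have e₉ : σ₉.arr 15 = σ₁.arr 15 := by rw [ag₉.2 15 (by decide), e₈]
  obtain ⟨v2, M, hM, v5⟩ := run_totalSize hh₁
  have v5₃ : σ₃.var 5 = M.card := by rw [ag₃.1 5 (by decide), v5]
  have v5₄ : σ₄.var 5 = M.card := by rw [ag₄.1 5 (by decide), v5₃]
  have hl := run_looseArray hh₂ hM v2 v5
  have hin := run_inevitableArray hh₃ hM v5₃
  have hal := run_allowedArray hh₄ hM v5₄
  -- The matrices in arrays `19` and `5` are built by setting entries to 1 only, so these arrays
  -- must still be zero as in the input.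
  have z19 : σ₅.arr 19 = fun _ => 0 := by
    rw [ag₅.2 19 (by decide), ag₄.2 19 (by decide), ag₃.2 19 (by decide), ag₂.2 19 (by decide),
      ag₁.2 19 (by decide)]
    rfl
  have z5 : σ₆.arr 5 = fun _ => 0 := by
    rw [ag₆.2 5 (by decide), ag₅.2 5 (by decide), ag₄.2 5 (by decide), ag₃.2 5 (by decide),
      ag₂.2 5 (by decide), ag₁.2 5 (by decide)]
    rfl
  have hin₅ : ∀ e : Fin x.m, IsTruthValue (σ₅.arr 17 (e : ℕ)) (x.G.Inevitable x.b e) := by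
    rw [ag₅.2 17 (by decide)]; exact hin
  have hF₆ := run_componentMatrix hh₅ (by rw [e₅]; exact n₁) z19 hin₅ hal
  have hord := run_orderMatrix hh₆ (by rw [e₆]; exact n₁) z5
    (by rw [ag₆.2 17 (by decide)]; exact hin₅) (by rw [ag₆.2 18 (by decide)]; exact hal)
  have hF₇ := hF₆.of_eq (ag₇.2 19 (by decide))
  have hlab := run_labels hh₇ (by rw [e₇]; exact n₁) hF₇
  have hF₈ := hF₇.of_eq (ag₈.2 19 (by decide))
  have hF₉ := hF₈.of_eq (ag₉.2 19 (by decide))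
  have hl₈ : ∀ v : Fin x.n, IsTruthValue (σ₈.arr 16 (v : ℕ)) (v ∈ x.G.looseVertices x.b) := by
    rw [ag₈.2 16 (by decide), ag₇.2 16 (by decide), ag₆.2 16 (by decide), ag₅.2 16 (by decide),
      ag₄.2 16 (by decide)]
    exact hl
  have hl₉ : ∀ v : Fin x.n, IsTruthValue (σ₉.arr 16 (v : ℕ)) (v ∈ x.G.looseVertices x.b) := by
    rw [ag₉.2 16 (by decide)]; exact hl₈
  have hA : ∀ v : Fin x.n, IsTruthValue (σ₉.arr 6 (v : ℕ))
      (x.G.InconsistentHookedBy x.b x.G.A (x.G.flexComp x.b v)) := fun v =>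
    (run_hooked (o := 6) (k := true) hh₈ (by rw [e₈]; exact n₁) hF₈ hl₈ (by decide) (by decide)
      (by decide) hh₈.arr3 hh₈.arr2 v).congr (inconsistentHookedBy_A_iff v).symm
  have hB : ∀ v : Fin x.n, IsTruthValue (σ₁₀.arr 7 (v : ℕ))
      (x.G.InconsistentHookedBy x.b x.G.B (x.G.flexComp x.b v)) := fun v =>
    (run_hooked (o := 7) (k := false) hh₉ (by rw [e₉]; exact n₁) hF₉ hl₉ (by decide) (by decide)
      (by decide) hh₉.arr2 hh₉.arr3 v).congr (inconsistentHookedBy_B_iff v).symm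
  have hA₁₀ : ∀ v : Fin x.n, IsTruthValue (σ₁₀.arr 6 (v : ℕ))
      (x.G.InconsistentHookedBy x.b x.G.A (x.G.flexComp x.b v)) := by
    rw [ag₁₀.2 6 (by decide)]; exact hA
  have hC := run_consistent hh₁₀.var0 hA₁₀ hB
  rw [hrun]
  refine ⟨?_, ?_, fun v => ⟨?_, ?_, (hC v).congr (not_congr (inconsistent_iff v).symm)⟩⟩
  · rw [ag₁₁.2 4 (by decide), ag₁₀.2 4 (by decide), ag₉.2 4 (by decide)]
    exact hlab
  · rw [ag₁₁.2 5 (by decide), ag₁₀.2 5 (by decide), ag₉.2 5 (by decide), ag₈.2 5 (by decide)]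
    exact hord
  · rw [ag₁₁.2 6 (by decide)]; exact hA₁₀ v
  · rw [ag₁₁.2 7 (by decide)]; exact hB v

end BMatchingInstance

theorem mainTheorem7 :
    RAM.StronglyPolynomialTime BMatchingInstance.dim BMatchingInstance.size
      BMatchingInstance.input BMatchingInstance.HoldsDecomposition :=
  -- Here `decide` checks the syntactic conditions that give the polynomial bounds.
  BMatchingInstance.stronglyPolynomialTime_of_run BMatchingInstance.decompose (by decide) _
    BMatchingInstance.holdsDecomposition_run
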